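/- Let $\mathcal S$ be the space of real Schwartz functions on $\mathbb R$ and $\mathcal S'$ its topological dual (with the strong topology and its Borel $\sigma$-field). Let $\alpha\in(0,2]$, let $p_t$ ($t>0$) be the transition density of the standard symmetric $\alpha$-stable Lévy process on $\mathbb R$, i.e. $\int_{\mathbb R} e^{ixy}p_t(y)\,dy=e^{-t|x|^\alpha}$, and put $\mathcal T_t\varphi=p_t*\varphi$ for $t>0$, $\mathcal T_0\varphi=\varphi$. Let $\theta$ be a random variable with values in $\{0,1,2,\dots\}$ and $E\theta^3<\infty$. Let $X=(X(t))_{t\ge0}$ be the density process: a centered Gaussian $\mathcal S'$-valued process with $$E\langle X(s),\varphi\rangle\langle X(t),\psi\rangle=E\theta\int_{\mathbb R}\varphi(x)\,\mathcal T_{|t-s|}\psi(x)\,dx+(\operatorname{Var}\theta-E\theta)\int_{\mathbb R}\mathcal T_s\varphi(x)\,\mathcal T_t\psi(x)\,dx,\qquad \varphi,\psi\in\mathcal S,\ s,t\ge0.$$ For $T>0$ and a norming $F_T>0$ define the $\mathcal S'$-valued random variable $\tilde Z_T$ by $\langle\tilde Z_T,\varphi\rangle=F_T^{-1}\langle X(1),\varphi(\cdot/T)\rangle$,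 $\varphi\in\mathcal S$. Write $\hat\varphi(x)=\int_{\mathbb R}e^{ixy}\varphi(y)\,dy$. (a) If $\operatorname{Var}\theta=0$ and $F_T=\sqrt{T^{1-\alpha}}$, then there is a centered Gaussian $\mathcal S'$-valued random variable $Z$ with covariance $$E\langle Z,\varphi\rangle\langle Z,\psi\rangle=\frac{E\theta}{\pi}\int_{\mathbb R}\hat\varphi(x)\overline{\hat\psi(x)}\,|x|^\alpha\,dx,\qquad\varphi,\psi\in\mathcal S,$$ and $\tilde Z_T$ converges in law in $\mathcal S'$ to $Z$ as $T\to\infty$. (b) If $\operatorname{Var}\theta>0$ and $F_T=\sqrt T$, then $\tilde Z_T$ converges in law in $\mathcal S'$, as $T\to\infty$, to $\sqrt{\operatorname{Var}\theta}\;W$, where $W$ is the white noise, i.e. the centered Gaussian $\mathcal S'$-valued random variable with $E\langle W,\varphi\rangle\langle W,\psi\rangle=\int_{\mathbb R}\varphi(x)\psi(x)\,dx$. -/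

import Mathlib

open MeasureTheory ProbabilityTheory Filter
open scoped SchwartzMap NNReal

noncomputable section

namespace DensityProcess

/-- The space `𝓢'` of real tempered distributions on `ℝ`: the topological dual of the real
Schwartz space, with its strong topology (uniform convergence on bounded subsets of `𝓢`), which is
Mathlib's topology on spaces of continuous linear maps. -/
abbrev SPrime : Type := 𝓢(ℝ, ℝ) →L[ℝ] ℝ

/-- `𝓢'` carries its Borel σ-algebra. -/
instance instMeasurableSpaceSPrime : MeasurableSpace SPrime := borel SPrime

instance instBorelSpaceSPrime : BorelSpace SPrime := ⟨rfl⟩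

/-- The transition density `p_t(x)` (for `t > 0`) of the standard symmetric `α`-stable Lévy process
on `ℝ`, that is, the density of the law with characteristic function `ξ ↦ exp (-t |ξ|^α)`, given by
Fourier inversion. -/
def stableDensity (α t x : ℝ) : ℝ :=
  (2 * Real.pi)⁻¹ * ∫ ξ : ℝ, Real.cos (x * ξ) * Real.exp (-(t * |ξ| ^ α))

/-- The semigroup `𝒯_t φ = p_t * φ` (`t > 0`) of the standard symmetric `α`-stable Lévy process,
with `𝒯_0 φ = φ`. -/
def stableSemigroup (α : ℝ) (t : ℝ≥0) (φ : ℝ → ℝ) (x : ℝ) : ℝ :=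
  if t = 0 then φ x else ∫ y : ℝ, stableDensity α t (x - y) * φ y

/-- The Fourier transform with the convention `φ̂(x) = ∫ e^{ixy} φ(y) dy`. -/
def fourierHat (φ : 𝓢(ℝ, ℝ)) (x : ℝ) : ℂ :=
  ∫ y : ℝ, Complex.exp (Complex.I * x * y) * (φ y : ℂ)

/-- The rescaling `S_T φ (x) = φ (x / T)` as a continuous linear map on the Schwartz space, for
`T ≠ 0` (the value at `T = 0` is irrelevant and set to `0`). -/
def scale (T : ℝ) : 𝓢(ℝ, ℝ) →L[ℝ] 𝓢(ℝ, ℝ) :=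
  if h : T = 0 then 0
  else SchwartzMap.compCLMOfContinuousLinearEquiv ℝ
    (ContinuousLinearEquiv.unitsEquivAut ℝ (Units.mk0 T h)⁻¹)

theorem scale_apply {T : ℝ} (hT : T ≠ 0) (φ : 𝓢(ℝ, ℝ)) (x : ℝ) : scale T φ x = φ (x / T) := by
  simp [scale, hT, div_eq_mul_inv]

/-- `Z` is a centered Gaussian `𝓢'`-valued random variable. -/
structure IsCenteredGaussian {Ω : Type*} [MeasurableSpace Ω] (Z : Ω → SPrime) (P : Measure Ω) :
    Prop where
  measurable : Measurable Z
  gaussian : IsGaussianProcess (fun (φ : 𝓢(ℝ, ℝ)) (ω : Ω) => Z ω φ) P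
  centered : ∀ φ : 𝓢(ℝ, ℝ), ∫ ω, Z ω φ ∂P = 0

/-- `W` is a (standard, real) white noise on `ℝ`. -/
structure IsWhiteNoise {Ω : Type*} [MeasurableSpace Ω] (W : Ω → SPrime) (P : Measure Ω) :
    Prop extends IsCenteredGaussian W P where
  covariance : ∀ φ ψ : 𝓢(ℝ, ℝ), ∫ ω, W ω φ * W ω ψ ∂P = ∫ x : ℝ, φ x * ψ x

/-- `X = (X(t))_{t ≥ 0}` is a density process with stability index `α` and parameters
`m` (the mean of `θ`) and `v` (the variance of `θ`): a centered Gaussian `𝓢'`-valued process with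
`E⟨X(s),φ⟩⟨X(t),ψ⟩ = m ∫ φ 𝒯_{|t-s|} ψ dx + (v - m) ∫ (𝒯_s φ) (𝒯_t ψ) dx`. -/
structure IsDensityProcess {Ω : Type*} [MeasurableSpace Ω] (α m v : ℝ) (X : ℝ≥0 → Ω → SPrime)
    (P : Measure Ω) : Prop where
  measurable : ∀ t, Measurable (X t)
  gaussian : IsGaussianProcess (fun (q : ℝ≥0 × 𝓢(ℝ, ℝ)) (ω : Ω) => X q.1 ω q.2) P
  centered : ∀ (t : ℝ≥0) (φ : 𝓢(ℝ, ℝ)), ∫ ω, X t ω φ ∂P = 0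
  covariance : ∀ (s t : ℝ≥0) (φ ψ : 𝓢(ℝ, ℝ)),
    ∫ ω, X s ω φ * X t ω ψ ∂P =
      m * (∫ x : ℝ, φ x * stableSemigroup α (nndist t s) ψ x) +
      (v - m) * ∫ x : ℝ, stableSemigroup α s φ x * stableSemigroup α t ψ x

/-- The random variable `⟨Z̃_T, φ⟩ = F_T⁻¹ ⟨X(1), S_T φ⟩`. -/
def rescaled {Ω : Type*} (F : ℝ → ℝ) (X : ℝ≥0 → Ω → SPrime) (T : ℝ) (ω : Ω) : SPrime :=
  (F T)⁻¹ • (X 1 ω).comp (scale T)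

end DensityProcess

end

/-!
Write `W T` for the rescaled variable. All variables are centered Gaussian, so everything is decided
by the variances `E ⟨W T, φ⟩²`. In Fourier coordinates `𝒯_1` is multiplication by
`exp (-|2πη|^α)`, and Plancherel's theorem gives (`IsDensityProcess.integral_rescaled_sq`)
`E ⟨W T, φ⟩² = F_T⁻² T ∫ |𝓕φ(η)|² (m + (v - m) exp (-2 |2πη/T|^α)) dη`,
where `m` and `v` are the mean and the variance of `θ`. If `v > 0` and `F_T² = T`, dominated
convergence yields the limit `v ∫ φ²`. If `v = 0` and `F_T² = T^{1-α}`, the integrand is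
`m |𝓕φ(η)|² T^α (1 - exp (-2 |2πη/T|^α))`, which is bounded by, and converges to,
`2m |2πη|^α |𝓕φ(η)|²`. In both cases the variances are at most a constant times
`energy φ = ∫ φ² + (φ')²`, uniformly in `T`; this uses `α ≤ 2` when `v = 0`.

Convergence of variances is upgraded to convergence in law in the strong topology of `𝓢'` in
`tendstoInDistribution_of_variance`, which needs no compactness argument. Let `V` be the Hilbert
space completion of `𝓢` for the norm `‖(M ∂)² M φ‖` of `L²(ℝ)`, where `M` is multiplication by
`1 + x²` (`SobolevSpace`). A weighted Sobolev inequality shows that the energy is a Hilbert–Schmidt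
form on `V` (`summable_energy`): there is an orthonormal basis of `V` made of Schwartz functions
`f i` with `∑ energy (f i) < ∞`. Consequently a random distribution with variances bounded by the
energy is almost surely the image, under a continuous linear map `V → 𝓢'`, of a random element of
`V` (`SchwartzBasis.exists_regularization`), which is approximated in mean by
`∑ i ∈ s, ⟨W, f i⟩ • f i`, uniformly over all such distributions. These finite dimensional
approximations converge in law by Lévy's theorem, hence so do the elements of `V`, and the
continuous mapping theorem transfers this to `𝓢'`.

The same regularization produces the limits: a linear map from `𝓢` to a Hilbert space which is
bounded for the energy norm, composed with an isonormal Gaussian process, is realized by a Gaussian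
law on `𝓢'` (`exists_isCenteredGaussian`).
-/

noncomputable section

namespace DensityProcess

/-! ### Weighted Sobolev norms on the Schwartz space -/

/-- Multiplication by the weight `1 + x²` on the real Schwartz space. -/
def weightCLM : 𝓢(ℝ, ℝ) →L[ℝ] 𝓢(ℝ, ℝ) := SchwartzMap.smulLeftCLM ℝ (fun x : ℝ => 1 + x ^ 2)

theorem weightCLM_apply (φ : 𝓢(ℝ, ℝ)) (x : ℝ) : weightCLM φ x = (1 + x ^ 2) * φ x := by
  rw [weightCLM, SchwartzMap.smulLeftCLM_apply_apply (by fun_prop), smul_eq_mul]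

/-- The first order operator `φ ↦ (1 + x²) φ'`. Its `L²` norm dominates the supremum of `φ`. -/
def weightDerivCLM : 𝓢(ℝ, ℝ) →L[ℝ] 𝓢(ℝ, ℝ) := weightCLM ∘L SchwartzMap.derivCLM ℝ ℝ

theorem weightDerivCLM_apply (φ : 𝓢(ℝ, ℝ)) (x : ℝ) :
    weightDerivCLM φ x = (1 + x ^ 2) * deriv φ x := by
  simp [weightDerivCLM, weightCLM_apply]

theorem memLp_two_inv_one_add_sq : MemLp (fun x : ℝ => (1 + x ^ 2)⁻¹) 2 := by
  rw [memLp_two_iff_integrable_sq (by fun_prop)]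
  refine Integrable.mono' integrable_inv_one_add_sq (by fun_prop) (ae_of_all _ fun x => ?_)
  have h1 : (1 + x ^ 2)⁻¹ ≤ 1 := inv_le_one_of_one_le₀ (by nlinarith)
  have h0 : 0 ≤ (1 + x ^ 2)⁻¹ := by positivity
  rw [Real.norm_of_nonneg (by positivity)]
  nlinarith

/-- The `L²(ℝ)` norm of `(1 + x²)⁻¹`, the constant of the Sobolev embedding below. -/
def sobolevConst : ℝ := (eLpNorm (fun x : ℝ => (1 + x ^ 2)⁻¹) 2 volume).toReal

theorem sobolevConst_nonneg : 0 ≤ sobolevConst := ENNReal.toReal_nonneg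

/-- Cauchy–Schwarz, after writing `φ' = (1 + x²)⁻¹ · (1 + x²) φ'`. -/
theorem integral_abs_deriv_le (φ : 𝓢(ℝ, ℝ)) :
    ∫ x, |deriv φ x| ≤ sobolevConst * ‖(weightDerivCLM φ).toLp 2‖ := by
  have hm := (weightDerivCLM φ).memLp 2
  have h := eLpNorm_smul_le_mul_eLpNorm (p := 2) (q := 2) (r := 1)
    hm.aestronglyMeasurable memLp_two_inv_one_add_sq.aestronglyMeasurable
  have hfun : ((fun x : ℝ => (1 + x ^ 2)⁻¹) • (weightDerivCLM φ : ℝ → ℝ)) = deriv φ := by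
    ext x
    have : (1 + x ^ 2 : ℝ) ≠ 0 := by positivity
    simp [weightDerivCLM_apply, this]
  rw [hfun] at h
  have hi : Integrable (deriv φ) := (SchwartzMap.derivCLM ℝ ℝ φ).integrable
  have h2 : ∫ x, |deriv φ x| = (eLpNorm (deriv φ) 1 volume).toReal := by
    rw [eLpNorm_one_eq_lintegral_enorm, ← integral_norm_eq_lintegral_enorm hi.1]
    rfl
  rw [h2, SchwartzMap.norm_toLp, sobolevConst, ← ENNReal.toReal_mul]
  exact ENNReal.toReal_mono
    (ENNReal.mul_ne_top memLp_two_inv_one_add_sq.2.ne hm.2.ne) h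

theorem abs_apply_le_integral_abs_deriv (φ : 𝓢(ℝ, ℝ)) (x : ℝ) : |φ x| ≤ ∫ y, |deriv φ y| := by
  have hi : Integrable (deriv φ) := (SchwartzMap.derivCLM ℝ ℝ φ).integrable
  have h := integral_Iic_of_hasDerivAt_of_tendsto' (a := x) (m := 0)
    (fun y _ => φ.hasDerivAt y) hi.integrableOn
    (φ.tendsto_cocompact.mono_left atBot_le_cocompact)
  rw [sub_zero] at h
  rw [← h]
  exact abs_integral_le_integral_abs.trans
    (setIntegral_le_integral hi.abs (ae_of_all _ fun _ => abs_nonneg _))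

/-- A weighted one-dimensional Sobolev embedding. -/
theorem abs_apply_le_norm_weightDerivCLM (φ : 𝓢(ℝ, ℝ)) (x : ℝ) :
    |φ x| ≤ sobolevConst * ‖(weightDerivCLM φ).toLp 2‖ :=
  (abs_apply_le_integral_abs_deriv φ x).trans (integral_abs_deriv_le φ)

/-- The continuous linear map `φ ↦ (M ∂)² M φ` into `L²(ℝ)`, where `M` is multiplication by
`1 + x²`. -/
def sobolevMap : 𝓢(ℝ, ℝ) →L[ℝ] Lp ℝ 2 (volume : Measure ℝ) :=
  SchwartzMap.toLpCLM ℝ ℝ 2 volume ∘L weightDerivCLM ∘L weightDerivCLM ∘L weightCLM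

/-- The `L²` norm of `sobolevMap φ` controls `φ` and `φ'` with a decay that is square integrable.
Each factor `M ∂` costs one use of the weighted Sobolev embedding, the factor `M` supplies the
decay. -/
theorem exists_weighted_bound :
    ∃ C : ℝ, 0 ≤ C ∧ ∀ (φ : 𝓢(ℝ, ℝ)) (x : ℝ),
      |φ x| ≤ C * (1 + x ^ 2)⁻¹ * ‖sobolevMap φ‖ ∧
      |deriv φ x| ≤ C * (1 + x ^ 2)⁻¹ * ‖sobolevMap φ‖ := by
  have hpi : (0 : ℝ) ≤ ∫ x : ℝ, (1 + x ^ 2)⁻¹ := integral_nonneg fun x => by positivity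
  set I := ∫ x : ℝ, (1 + x ^ 2)⁻¹ with hI
  have hc := sobolevConst_nonneg
  refine ⟨sobolevConst * (1 + I), by positivity, fun φ x => ?_⟩
  set N := ‖sobolevMap φ‖ with hN
  have hN0 : 0 ≤ N := norm_nonneg _
  set u := weightCLM φ with hu
  have h1 : ∀ y, |weightDerivCLM u y| ≤ sobolevConst * N := fun y =>
    abs_apply_le_norm_weightDerivCLM _ y
  have hpos : ∀ y : ℝ, 0 < 1 + y ^ 2 := fun y => by positivity
  have h2 : ∀ y, |deriv u y| ≤ sobolevConst * N * (1 + y ^ 2)⁻¹ := fun y => by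
    have := h1 y
    rw [weightDerivCLM_apply, abs_mul, abs_of_pos (hpos y)] at this
    rw [← div_eq_mul_inv, le_div_iff₀ (hpos y)]
    linarith
  have hi : Integrable (deriv u) := (SchwartzMap.derivCLM ℝ ℝ u).integrable
  have h3 : ∀ y, |u y| ≤ sobolevConst * N * I := fun y => by
    refine (abs_apply_le_integral_abs_deriv u y).trans ?_
    rw [hI, ← integral_const_mul]
    exact integral_mono hi.abs (integrable_inv_one_add_sq.const_mul _) h2
  have h4 : (1 + x ^ 2) * |φ x| ≤ sobolevConst * N * I := by
    have := h3 x
    rwa [hu, weightCLM_apply, abs_mul, abs_of_pos (hpos x)] at this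
  have hx := hpos x
  constructor
  · have : |φ x| ≤ sobolevConst * N * I * (1 + x ^ 2)⁻¹ := by
      rw [← div_eq_mul_inv, le_div_iff₀ hx]; linarith
    have h5 : 0 ≤ sobolevConst * N * (1 + x ^ 2)⁻¹ := by positivity
    nlinarith
  · have hd : deriv u x = 2 * x * φ x + (1 + x ^ 2) * deriv φ x := by
      have e : (u : ℝ → ℝ) = fun y => (1 + y ^ 2) * φ y := funext fun y => weightCLM_apply φ y
      have h := ((((hasDerivAt_id x).pow 2).const_add 1).mul (φ.hasDerivAt x)).deriv
      rw [e]
      exact h.trans (by simp)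
    have h6 : (1 + x ^ 2) * deriv φ x = deriv u x - 2 * x * φ x := by rw [hd]; ring
    have h7 : |2 * x * φ x| ≤ sobolevConst * N * I := by
      refine le_trans ?_ h4
      rw [abs_mul, abs_mul, abs_two]
      refine mul_le_mul_of_nonneg_right ?_ (abs_nonneg _)
      nlinarith [sq_nonneg (|x| - 1), sq_abs x]
    have h8 : |deriv u x| ≤ sobolevConst * N :=
      (h2 x).trans (mul_le_of_le_one_right (by positivity)
        (inv_le_one_of_one_le₀ (by nlinarith [sq_nonneg x])))
    have h9 : (1 + x ^ 2) * |deriv φ x| ≤ sobolevConst * (1 + I) * N := by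
      rw [← abs_of_pos hx, ← abs_mul, h6]
      exact (abs_sub _ _).trans (by linarith)
    rw [mul_right_comm, ← div_eq_mul_inv, le_div_iff₀ hx]
    linarith

/-- The Schwartz topology is generated by countably many `L²` norms of differential operators with
polynomial coefficients, so it inherits second countability from `L²(ℝ)`. -/
instance instSecondCountableTopologySchwartz : SecondCountableTopology 𝓢(ℝ, ℝ) := by
  let A : ℕ × ℕ → 𝓢(ℝ, ℝ) →L[ℝ] Lp ℝ 2 (volume : Measure ℝ) := fun m =>
    SchwartzMap.toLpCLM ℝ ℝ 2 volume ∘L weightDerivCLM ∘L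
      (weightCLM ^ m.1) ∘L ((SchwartzMap.derivCLM ℝ ℝ) ^ m.2)
  have hw : ∀ (k : ℕ) (φ : 𝓢(ℝ, ℝ)) (x : ℝ), (weightCLM ^ k) φ x = (1 + x ^ 2) ^ k * φ x := by
    intro k
    induction k with
    | zero => intro φ x; simp
    | succ k ih => intro φ x; rw [pow_succ, mul_apply_eq_comp, ih, weightCLM_apply]; ring
  have hd : ∀ (n : ℕ) (φ : 𝓢(ℝ, ℝ)), (((SchwartzMap.derivCLM ℝ ℝ) ^ n) φ : ℝ → ℝ) =
      iteratedDeriv n φ := by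
    intro n
    induction n with
    | zero => intro φ; simp
    | succ n ih =>
      intro φ
      rw [pow_succ, mul_apply_eq_comp, ih, iteratedDeriv_succ']
      rfl
  have hA : ∀ (m : ℕ × ℕ) (φ : 𝓢(ℝ, ℝ)),
      SchwartzMap.seminorm ℝ m.1 m.2 φ ≤ sobolevConst * ‖A m φ‖ := by
    rintro ⟨k, n⟩ φ
    refine SchwartzMap.seminorm_le_bound' ℝ k n φ
      (mul_nonneg sobolevConst_nonneg (norm_nonneg _)) fun x => ?_
    refine le_trans ?_ (abs_apply_le_norm_weightDerivCLM
      ((weightCLM ^ k) (((SchwartzMap.derivCLM ℝ ℝ) ^ n) φ)) x)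
    rw [hw, hd, abs_mul, abs_pow, Real.norm_eq_abs]
    refine mul_le_mul_of_nonneg_right (pow_le_pow_left₀ (abs_nonneg x) ?_ k) (abs_nonneg _)
    rw [abs_of_pos (by positivity : (0 : ℝ) < 1 + x ^ 2)]
    nlinarith [sq_nonneg (|x| - 1), sq_abs x]
  let q : SeminormFamily ℝ 𝓢(ℝ, ℝ) (ℕ × ℕ) := fun m => (normSeminorm ℝ _).comp (A m).toLinearMap
  have hq : WithSeminorms q := by
    refine (schwartz_withSeminorms ℝ ℝ ℝ).congr (fun m => ?_) (fun m => ?_)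
    · obtain ⟨s, C, -, hC⟩ := Seminorm.bound_of_continuous (schwartz_withSeminorms ℝ ℝ ℝ) (q m)
        ((A m).continuous.norm)
      exact ⟨s, C, hC⟩
    · refine ⟨{m}, ⟨sobolevConst, sobolevConst_nonneg⟩, fun φ => ?_⟩
      rw [Finset.sup_singleton]
      exact hA m φ
  have htop : SchwartzMap.instTopologicalSpace ℝ ℝ =
      ⨅ m, TopologicalSpace.induced (A m) inferInstance := by
    refine IsTopologicalAddGroup.ext inferInstance
      (topologicalAddGroup_iInf fun m => topologicalAddGroup_induced (A m)) ?_
    rw [q.withSeminorms_iff_nhds_eq_iInf.mp hq, nhds_iInf]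
    refine iInf_congr fun m => ?_
    rw [nhds_induced, map_zero, ← comap_norm_nhds_zero (E := Lp ℝ 2 (volume : Measure ℝ)),
      comap_comap]
    rfl
  have : Fact ((2 : ENNReal) ≠ ⊤) := ⟨ENNReal.ofNat_ne_top⟩
  rw [htop]
  exact TopologicalSpace.secondCountableTopology_iInf fun m =>
    TopologicalSpace.secondCountableTopology_induced _ _ _

/-! ### Nuclearity: the energy is a Hilbert–Schmidt form -/

/-- Gram–Schmidt inside a dense subspace: a separable Hilbert space has an orthonormal basis whose
members lie in the range of a given linear map with dense range. -/
theorem exists_hilbertBasis_mem_range {S V : Type*} [AddCommGroup S] [Module ℝ S]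
    [NormedAddCommGroup V] [InnerProductSpace ℝ V] [CompleteSpace V] [SecondCountableTopology V]
    (J : S →ₗ[ℝ] V) (hJ : DenseRange J) :
    ∃ (ι : Set ℕ) (b : HilbertBasis ι ℝ V) (f : ι → S), ∀ i, J (f i) = b i := by
  obtain ⟨s, hs, hsd⟩ :
      ∃ s : Set V, s ⊆ Set.range J ∧ s.Countable ∧ Dense s := by
    obtain ⟨c, hc, hcd⟩ := TopologicalSpace.exists_countable_dense (Set.range J)
    refine ⟨(↑) '' c, by rintro _ ⟨x, -, rfl⟩; exact x.2, hc.image _, ?_⟩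
    exact DenseRange.dense_image (by rwa [DenseRange, Subtype.range_coe])
      continuous_subtype_val hcd
  obtain ⟨d, hd⟩ : ∃ d : ℕ → V, s = Set.range d := hsd.1.exists_eq_range hsd.2.nonempty
  let g := InnerProductSpace.gramSchmidtNormed ℝ d
  have hon := InnerProductSpace.gramSchmidtNormed_orthonormal' (𝕜 := ℝ) d
  -- the Gram–Schmidt vectors of linearly dependent terms vanish and are discarded
  have hspan : Submodule.span ℝ (Set.range d) =
      Submodule.span ℝ (Set.range fun i : {i | g i ≠ 0} => g i) := by
    rw [← InnerProductSpace.span_gramSchmidt ℝ d,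
      ← InnerProductSpace.span_gramSchmidtNormed_range]
    refine le_antisymm (Submodule.span_le.mpr ?_) (Submodule.span_mono ?_)
    · rintro _ ⟨n, rfl⟩
      by_cases h : g n = 0
      · change g n ∈ _
        rw [h]; exact Submodule.zero_mem _
      · exact Submodule.subset_span ⟨⟨n, h⟩, rfl⟩
    · rintro _ ⟨n, rfl⟩
      exact ⟨n, rfl⟩
  have htop : ⊤ ≤ (Submodule.span ℝ
      (Set.range fun i : {i | g i ≠ 0} => g i)).topologicalClosure := by
    rw [← hspan, ← hd]
    intro x _
    exact closure_mono Submodule.subset_span (hsd.2 x)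
  have hmem : ∀ i : {i | g i ≠ 0}, ∃ x, J x = g i := by
    intro i
    have h : g i ∈ Submodule.span ℝ (Set.range d) := by
      rw [hspan]; exact Submodule.subset_span ⟨i, rfl⟩
    have : Submodule.span ℝ (Set.range d) ≤ LinearMap.range J := by
      rw [Submodule.span_le, ← hd]
      exact hs
    exact this h
  choose f hf using hmem
  exact ⟨{i | g i ≠ 0}, HilbertBasis.mk hon htop, f, fun i => by
    rw [HilbertBasis.coe_mk]; exact hf i⟩

/-- The first order Sobolev energy `∫ φ² + (φ')²`. -/
def energy (φ : 𝓢(ℝ, ℝ)) : ℝ := ∫ x, (φ x ^ 2 + deriv φ x ^ 2)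

theorem integrable_sq (φ : 𝓢(ℝ, ℝ)) : Integrable fun x => φ x ^ 2 :=
  (memLp_two_iff_integrable_sq φ.continuous.aestronglyMeasurable).1 (φ.memLp 2)

theorem integrable_energy (φ : 𝓢(ℝ, ℝ)) : Integrable fun x => φ x ^ 2 + deriv φ x ^ 2 :=
  (integrable_sq φ).add (integrable_sq (SchwartzMap.derivCLM ℝ ℝ φ))

theorem energy_nonneg (φ : 𝓢(ℝ, ℝ)) : 0 ≤ energy φ :=
  integral_nonneg fun x => by positivity

/-- The Hilbert space in which the random distributions are realised: the closure in `L²(ℝ)` of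
the range of `sobolevMap`. -/
def SobolevSpace : Type :=
  (LinearMap.range sobolevMap.toLinearMap).topologicalClosure

instance : NormedAddCommGroup SobolevSpace :=
  inferInstanceAs
    (NormedAddCommGroup (LinearMap.range sobolevMap.toLinearMap).topologicalClosure)

instance : InnerProductSpace ℝ SobolevSpace :=
  inferInstanceAs
    (InnerProductSpace ℝ (LinearMap.range sobolevMap.toLinearMap).topologicalClosure)

instance : CompleteSpace SobolevSpace :=
  (Submodule.isClosed_topologicalClosure _).completeSpace_coe

instance : SecondCountableTopology SobolevSpace :=
  have : Fact ((2 : ENNReal) ≠ ⊤) := ⟨ENNReal.ofNat_ne_top⟩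
  inferInstanceAs
    (SecondCountableTopology (LinearMap.range sobolevMap.toLinearMap).topologicalClosure)

instance : MeasurableSpace SobolevSpace := borel _

instance : BorelSpace SobolevSpace := ⟨rfl⟩

/-- The embedding of the Schwartz space into `SobolevSpace`. -/
def embed : 𝓢(ℝ, ℝ) →L[ℝ] SobolevSpace :=
  sobolevMap.codRestrict _ fun φ => subset_closure ⟨φ, rfl⟩

theorem norm_embed (φ : 𝓢(ℝ, ℝ)) : ‖embed φ‖ = ‖sobolevMap φ‖ := rfl

theorem denseRange_embed : DenseRange embed := by
  intro x
  refine (closure_subtype (X := Lp ℝ 2 (volume : Measure ℝ))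
    (p := (· ∈ (LinearMap.range sobolevMap.toLinearMap).topologicalClosure))).2 ?_
  refine closure_mono ?_ x.2
  rintro _ ⟨φ, rfl⟩
  exact ⟨embed φ, ⟨φ, rfl⟩, rfl⟩

/-- The energy is continuous for the norm of `SobolevSpace`. -/
theorem exists_energy_le : ∃ C : ℝ, 0 ≤ C ∧ ∀ φ, energy φ ≤ C * ‖embed φ‖ ^ 2 := by
  obtain ⟨C, hC0, hC⟩ := exists_weighted_bound
  have hI : Integrable fun x : ℝ => ((1 + x ^ 2)⁻¹) ^ 2 :=
    (memLp_two_iff_integrable_sq (by fun_prop)).1 memLp_two_inv_one_add_sq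
  refine ⟨∫ x : ℝ, 2 * C ^ 2 * ((1 + x ^ 2)⁻¹) ^ 2, integral_nonneg fun x => by positivity,
    fun φ => ?_⟩
  rw [← integral_mul_const]
  refine integral_mono (integrable_energy φ) ((hI.const_mul _).mul_const _) fun x => ?_
  have h1 := pow_le_pow_left₀ (abs_nonneg _) (hC φ x).1 2
  have h2 := pow_le_pow_left₀ (abs_nonneg _) (hC φ x).2 2
  rw [sq_abs, ← norm_embed] at h1 h2
  dsimp only
  nlinarith

/-- Evaluation functionals turn an orthonormal system into a pointwise bounded one. -/
theorem sum_sq_le_of_orthonormal {ι : Type*} {b : ι → SobolevSpace} (hb : Orthonormal ℝ b)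
    {f : ι → 𝓢(ℝ, ℝ)} (hf : ∀ i, embed (f i) = b i) (ℓ : 𝓢(ℝ, ℝ) →ₗ[ℝ] ℝ) {c : ℝ}
    (hc : ∀ φ, |ℓ φ| ≤ c * ‖embed φ‖) (s : Finset ι) : ∑ i ∈ s, ℓ (f i) ^ 2 ≤ c ^ 2 := by
  -- test the bound on `∑ i ∈ s, ℓ (f i) • f i`, whose embedding has squared norm `A`
  set A := ∑ i ∈ s, ℓ (f i) ^ 2 with hA
  have hA0 : 0 ≤ A := Finset.sum_nonneg fun i _ => sq_nonneg _
  have h := hc (∑ i ∈ s, ℓ (f i) • f i)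
  have h1 : ℓ (∑ i ∈ s, ℓ (f i) • f i) = A := by
    simp [map_sum, hA, sq]
  have h2 : ‖embed (∑ i ∈ s, ℓ (f i) • f i)‖ ^ 2 = A := by
    rw [map_sum, ← real_inner_self_eq_norm_sq]
    simp only [map_smul, hf]
    rw [hb.inner_sum]
    simp [hA, sq]
  rw [h1, abs_of_nonneg hA0] at h
  have h3 := pow_le_pow_left₀ hA0 h 2
  rw [mul_pow, h2] at h3
  by_contra! hlt
  nlinarith [sq_nonneg c]

/-- The energy is a Hilbert–Schmidt form with respect to the norm of `SobolevSpace`. -/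
theorem summable_energy {ι : Type*} {b : ι → SobolevSpace} (hb : Orthonormal ℝ b)
    {f : ι → 𝓢(ℝ, ℝ)} (hf : ∀ i, embed (f i) = b i) : Summable fun i => energy (f i) := by
  obtain ⟨C, hC0, hC⟩ := exists_weighted_bound
  have hI : Integrable fun x : ℝ => ((1 + x ^ 2)⁻¹) ^ 2 :=
    (memLp_two_iff_integrable_sq (by fun_prop)).1 memLp_two_inv_one_add_sq
  -- sum the pointwise bounds for the functionals `φ ↦ φ x` and `φ ↦ φ' x`, then integrate over `x`
  refine summable_of_sum_le (fun i => energy_nonneg _)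
    (c := ∫ x : ℝ, 2 * C ^ 2 * ((1 + x ^ 2)⁻¹) ^ 2) fun s => ?_
  unfold energy
  rw [← integral_finsetSum _ fun i _ => integrable_energy (f i)]
  refine integral_mono (integrable_finsetSum _ fun i _ => integrable_energy (f i))
    (hI.const_mul _) fun x => ?_
  have h1 := sum_sq_le_of_orthonormal hb hf
    { toFun := fun φ => φ x, map_add' := fun _ _ => rfl, map_smul' := fun _ _ => rfl }
    (c := C * (1 + x ^ 2)⁻¹) (fun φ => (hC φ x).1) s
  have h2 := sum_sq_le_of_orthonormal hb hf
    { toFun := fun φ => SchwartzMap.derivCLM ℝ ℝ φ x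
      map_add' := fun _ _ => by simp only [map_add]; rfl
      map_smul' := fun _ _ => by simp only [map_smul]; rfl }
    (c := C * (1 + x ^ 2)⁻¹) (fun φ => (hC φ x).2) s
  simp only [LinearMap.coe_mk, AddHom.coe_mk, SchwartzMap.derivCLM_apply] at h1 h2
  simp only [Finset.sum_add_distrib]
  linarith [mul_pow C ((1 + x ^ 2)⁻¹) 2]

/-! ### Random linear functionals as random elements of a Hilbert space -/

/-- For a unit vector `u`, the isometric embedding `a ↦ a • u` of scalar `L²` into vector valued
`L²`. -/
def lpSmulVector {Ω V : Type*} [MeasurableSpace Ω] (P : Measure Ω) [NormedAddCommGroup V]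
    [NormedSpace ℝ V] (u : V) (hu : ‖u‖ = 1) : Lp ℝ 2 P →ₗᵢ[ℝ] Lp V 2 P where
  toLinearMap := ((ContinuousLinearMap.toSpanSingleton ℝ u).compLpL 2 P).toLinearMap
  norm_map' a := by
    rw [Lp.norm_def, Lp.norm_def]
    congr 1
    refine eLpNorm_congr_norm_ae ?_
    filter_upwards [(ContinuousLinearMap.toSpanSingleton ℝ u).coeFn_compLpL (p := 2) (μ := P) a]
      with ω hω
    refine (congrArg norm hω).trans ?_
    simp [norm_smul, hu]

theorem coeFn_lpSmulVector {Ω V : Type*} [MeasurableSpace Ω] (P : Measure Ω)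
    [NormedAddCommGroup V] [NormedSpace ℝ V] (u : V) (hu : ‖u‖ = 1) (a : Lp ℝ 2 P) :
    lpSmulVector P u hu a =ᵐ[P] fun ω => a ω • u :=
  (ContinuousLinearMap.toSpanSingleton ℝ u).coeFn_compLpL (p := 2) (μ := P) a

theorem orthogonalFamily_lpSmulVector {Ω V ι : Type*} [MeasurableSpace Ω] (P : Measure Ω)
    [NormedAddCommGroup V] [InnerProductSpace ℝ V] {b : ι → V} (hb : Orthonormal ℝ b) :
    OrthogonalFamily ℝ (fun _ : ι => Lp ℝ 2 P) fun i => lpSmulVector P (b i) (hb.1 i) := by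
  intro i j hij v w
  rw [L2.inner_def]
  refine integral_eq_zero_of_ae ?_
  filter_upwards [coeFn_lpSmulVector P (b i) (hb.1 i) v, coeFn_lpSmulVector P (b j) (hb.1 j) w]
    with ω h1 h2
  simp [h1, h2, real_inner_smul_left, real_inner_smul_right, hb.2 hij]

/-- A Hilbert basis of `SobolevSpace` consisting of (images of) Schwartz functions. -/
structure SchwartzBasis (ι : Type*) where
  /-- The orthonormal basis. -/
  basis : HilbertBasis ι ℝ SobolevSpace
  /-- Schwartz functions representing the basis vectors. -/
  fn : ι → 𝓢(ℝ, ℝ)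
  embed_fn : ∀ i, embed (fn i) = basis i

theorem nonempty_schwartzBasis : ∃ ι : Set ℕ, Nonempty (SchwartzBasis ι) := by
  obtain ⟨ι, b, f, h⟩ := exists_hilbertBasis_mem_range embed.toLinearMap denseRange_embed
  exact ⟨ι, ⟨⟨b, f, h⟩⟩⟩

namespace SchwartzBasis

variable {ι : Type*} (B : SchwartzBasis ι) {Ω : Type*} [MeasurableSpace Ω] (P : Measure Ω)

theorem summable_energy : Summable fun i => energy (B.fn i) :=
  DensityProcess.summable_energy B.basis.orthonormal B.embed_fn

/-- The sum of the energies of the basis functions outside a finite set. -/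
def tail (s : Finset ι) : ℝ := (∑' i, energy (B.fn i)) - ∑ i ∈ s, energy (B.fn i)

theorem tendsto_tail : Tendsto B.tail atTop (nhds 0) := by
  have := (tendsto_const_nhds (x := ∑' i, energy (B.fn i))).sub B.summable_energy.hasSum
  rwa [sub_self] at this

/-- The isometry of scalar `L²` onto the multiples of the `i`-th basis vector. -/
def smulL (i : ι) : Lp ℝ 2 P →ₗᵢ[ℝ] Lp SobolevSpace 2 P :=
  lpSmulVector P (B.basis i) (B.basis.orthonormal.1 i)

/-- Regularisation of a random linear functional on the Schwartz space: if its second moments are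
dominated by the energy, it is given by pairing with a random element of `SobolevSpace`, and finite
partial sums approximate this element at a rate depending only on the domination constant. -/
theorem exists_realization (ξ : 𝓢(ℝ, ℝ) →ₗ[ℝ] Lp ℝ 2 P) {K : ℝ}
    (hK : 0 ≤ K) (hξ : ∀ φ, ‖ξ φ‖ ^ 2 ≤ K * energy φ) :
    ∃ Y : Lp SobolevSpace 2 P, (∀ φ, (fun ω => inner ℝ (Y ω) (embed φ)) =ᵐ[P] ξ φ) ∧
      ∀ s : Finset ι, ‖Y - ∑ i ∈ s, B.smulL P i (ξ (B.fn i))‖ ^ 2 ≤ K * B.tail s := by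
  classical
  have hO : OrthogonalFamily ℝ (E := Lp SobolevSpace 2 P) (fun _ : ι => Lp ℝ 2 P)
      (fun i => B.smulL P i) :=
    orthogonalFamily_lpSmulVector P B.basis.orthonormal
  have hsum : Summable fun i => ‖ξ (B.fn i)‖ ^ 2 :=
    (B.summable_energy.mul_left K).of_nonneg_of_le (fun i => sq_nonneg _) fun i => hξ _
  obtain ⟨Y, hY⟩ := (hO.summable_iff_norm_sq_summable fun i => ξ (B.fn i)).2 hsum
  refine ⟨Y, fun φ => ?_, fun s => ?_⟩
  · -- both sides are the `L²` sum of `⟪bᵢ, embed φ⟫ ξ(fᵢ)`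
    let Λ : Lp SobolevSpace 2 P →L[ℝ] Lp ℝ 2 P := (innerSL ℝ (embed φ)).compLpL 2 P
    have hΛ : ∀ Z, Λ Z =ᵐ[P] fun ω => inner ℝ (embed φ) (Z ω) := fun Z =>
      (innerSL ℝ (embed φ)).coeFn_compLpL Z
    have h1 : HasSum (fun i => inner ℝ (B.basis i) (embed φ) • ξ (B.fn i)) (Λ Y) := by
      convert hY.mapL Λ using 2 with i
      refine Lp.ext ?_
      filter_upwards [hΛ (B.smulL P i (ξ (B.fn i))),
        coeFn_lpSmulVector P (B.basis i) (B.basis.orthonormal.1 i) (ξ (B.fn i)),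
        Lp.coeFn_smul (inner ℝ (B.basis i) (embed φ)) (ξ (B.fn i))] with ω ha hb hc
      rw [ha, hc, smulL, hb, real_inner_smul_right, real_inner_comm, Pi.smul_apply, smul_eq_mul,
        mul_comm]
    have h2 : HasSum (fun i => inner ℝ (B.basis i) (embed φ) • ξ (B.fn i)) (ξ φ) := by
      obtain ⟨C, hC0, hC⟩ := exists_energy_le
      have hb := B.basis.hasSum_repr (embed φ)
      simp only [B.basis.repr_apply_apply] at hb
      rw [HasSum, tendsto_iff_norm_sub_tendsto_zero] at hb ⊢
      have hb2 : Tendsto (fun s : Finset ι => √(K * C *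
          ‖∑ i ∈ s, inner ℝ (B.basis i) (embed φ) • B.basis i - embed φ‖ ^ 2))
          (SummationFilter.unconditional ι).filter (nhds 0) := by
        have := ((hb.pow 2).const_mul (K * C)).sqrt
        simpa using this
      refine squeeze_zero (fun s => norm_nonneg _) (fun s => ?_) hb2
      refine Real.le_sqrt_of_sq_le ?_
      have e1 : ∑ i ∈ s, inner ℝ (B.basis i) (embed φ) • ξ (B.fn i) - ξ φ =
          ξ (∑ i ∈ s, inner ℝ (B.basis i) (embed φ) • B.fn i - φ) := by
        simp [map_sum]
      have e2 : ∑ i ∈ s, inner ℝ (B.basis i) (embed φ) • B.basis i - embed φ =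
          embed (∑ i ∈ s, inner ℝ (B.basis i) (embed φ) • B.fn i - φ) := by
        simp [map_sum, B.embed_fn]
      rw [e1, e2]
      set ψ := ∑ i ∈ s, inner ℝ (B.basis i) (embed φ) • B.fn i - φ
      calc ‖ξ ψ‖ ^ 2 ≤ K * energy ψ := hξ ψ
        _ ≤ K * (C * ‖embed ψ‖ ^ 2) := by gcongr; exact hC ψ
        _ = _ := by ring
    have h3 := h1.unique h2
    filter_upwards [hΛ Y] with ω hω
    rw [real_inner_comm, ← hω, h3]
  · have hY' : Tendsto (fun t : Finset ι => ∑ i ∈ t, B.smulL P i (ξ (B.fn i))) atTop (nhds Y) := by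
      simpa only [HasSum, SummationFilter.unconditional_filter] using hY
    have h1 : Tendsto (fun t : Finset ι => ‖∑ i ∈ t, B.smulL P i (ξ (B.fn i)) -
        ∑ i ∈ s, B.smulL P i (ξ (B.fn i))‖ ^ 2) atTop
        (nhds (‖Y - ∑ i ∈ s, B.smulL P i (ξ (B.fn i))‖ ^ 2)) := by
      have h2 := hY'.sub_const (∑ i ∈ s, B.smulL P i (ξ (B.fn i)))
      exact (Tendsto.norm (E := Lp SobolevSpace 2 P) h2).pow 2
    refine le_of_tendsto h1 ?_
    filter_upwards [eventually_ge_atTop s] with t ht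
    have hst : ∑ i ∈ t, B.smulL P i (ξ (B.fn i)) - ∑ i ∈ s, B.smulL P i (ξ (B.fn i)) =
        ∑ i ∈ t \ s, B.smulL P i (ξ (B.fn i)) :=
      sub_eq_of_eq_add (Finset.sum_sdiff ht).symm
    rw [hst, hO.norm_sum (fun i => ξ (B.fn i))]
    calc ∑ i ∈ t \ s, ‖ξ (B.fn i)‖ ^ 2 ≤ ∑ i ∈ t \ s, K * energy (B.fn i) :=
          Finset.sum_le_sum fun i _ => hξ _
      _ = K * (∑ i ∈ t, energy (B.fn i) - ∑ i ∈ s, energy (B.fn i)) := by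
          rw [← Finset.mul_sum, ← Finset.sum_sdiff ht]; ring
      _ ≤ K * B.tail s := by
          refine mul_le_mul_of_nonneg_left (sub_le_sub_right ?_ _) hK
          exact B.summable_energy.sum_le_tsum t fun _ _ => energy_nonneg _

end SchwartzBasis

/-- The random element `h` of `SobolevSpace` seen as the tempered distribution
`φ ↦ ⟪h, embed φ⟫`. -/
def toDistribution : SobolevSpace →L[ℝ] SPrime :=
  (ContinuousLinearMap.precomp ℝ embed) ∘L (innerSL ℝ : SobolevSpace →L[ℝ] SobolevSpace →L[ℝ] ℝ)

theorem toDistribution_apply (h : SobolevSpace) (φ : 𝓢(ℝ, ℝ)) :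
    toDistribution h φ = inner ℝ h (embed φ) := rfl

theorem norm_toLp_two_sq {Ω : Type*} [MeasurableSpace Ω] {P : Measure Ω} {f : Ω → ℝ}
    (hf : MemLp f 2 P) : ‖hf.toLp f‖ ^ 2 = ∫ ω, f ω ^ 2 ∂P := by
  rw [← real_inner_self_eq_norm_sq, L2.inner_def]
  refine integral_congr_ae ?_
  filter_upwards [hf.coeFn_toLp] with ω hω
  simp [hω, sq]

theorem integral_norm_le_norm_Lp_two {Ω V : Type*} [MeasurableSpace Ω] {P : Measure Ω}
    [IsProbabilityMeasure P] [NormedAddCommGroup V] (Z : Lp V 2 P) : ∫ ω, ‖Z ω‖ ∂P ≤ ‖Z‖ := by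
  have h := Lp.memLp Z
  rw [integral_norm_eq_lintegral_enorm h.1, ← eLpNorm_one_eq_lintegral_enorm, Lp.norm_def]
  exact ENNReal.toReal_mono h.2.ne
    (eLpNorm_le_eLpNorm_of_exponent_le (by norm_num) h.1)

/-- A random tempered distribution with second moments dominated by the energy takes values,
almost surely, in `SobolevSpace`. Separability of the Schwartz space allows one exceptional null
set for all test functions. -/
theorem SchwartzBasis.exists_regularization {ι Ω : Type*} (B : SchwartzBasis ι)
    [MeasurableSpace Ω] {P : Measure Ω} [IsProbabilityMeasure P] {W : Ω → SPrime} {K : ℝ}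
    (hK : 0 ≤ K) (hm : ∀ φ, MemLp (fun ω => W ω φ) 2 P)
    (hE : ∀ φ, ∫ ω, W ω φ ^ 2 ∂P ≤ K * energy φ) :
    ∃ Y : Ω → SobolevSpace, MemLp Y 2 P ∧ W =ᵐ[P] (fun ω => toDistribution (Y ω)) ∧
      ∀ s : Finset ι, ∫ ω, ‖Y ω - ∑ i ∈ s, W ω (B.fn i) • B.basis i‖ ∂P ≤ √(K * B.tail s) := by
  let ξ : 𝓢(ℝ, ℝ) →ₗ[ℝ] Lp ℝ 2 P :=
    { toFun := fun φ => (hm φ).toLp _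
      map_add' := fun φ ψ => by
        rw [← MemLp.toLp_add]
        congr 1
        ext ω
        exact map_add (W ω) φ ψ
      map_smul' := fun c φ => by
        rw [RingHom.id_apply, ← MemLp.toLp_const_smul]
        congr 1
        ext ω
        exact map_smul (W ω) c φ }
  have hξ : ∀ φ, ξ φ =ᵐ[P] fun ω => W ω φ := fun φ => (hm φ).coeFn_toLp
  obtain ⟨Y, hY, hYs⟩ := B.exists_realization P ξ hK fun φ => by
    refine (norm_toLp_two_sq (hm φ)).le.trans (hE φ)
  refine ⟨Y, Lp.memLp Y, ?_, fun s => ?_⟩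
  · have hd : ∀ᵐ ω ∂P, ∀ n, W ω (TopologicalSpace.denseSeq 𝓢(ℝ, ℝ) n) =
        toDistribution (Y ω) (TopologicalSpace.denseSeq 𝓢(ℝ, ℝ) n) := by
      rw [ae_all_iff]
      intro n
      filter_upwards [hξ (TopologicalSpace.denseSeq 𝓢(ℝ, ℝ) n),
        hY (TopologicalSpace.denseSeq 𝓢(ℝ, ℝ) n)] with ω h1 h2
      rw [← h1, ← h2, toDistribution_apply]
    filter_upwards [hd] with ω hω
    refine ContinuousLinearMap.coe_injective (LinearMap.ext ?_)
    exact congrFun ((TopologicalSpace.denseRange_denseSeq 𝓢(ℝ, ℝ)).equalizer (W ω).continuous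
      (toDistribution (Y ω)).continuous (funext hω))
  · have h1 : ∀ᵐ ω ∂P, ∀ i : s, B.smulL P i (ξ (B.fn i)) ω = W ω (B.fn i) • B.basis i := by
      rw [ae_all_iff]
      intro i
      filter_upwards [hξ (B.fn i), coeFn_lpSmulVector P (B.basis i) (B.basis.orthonormal.1 i)
        (ξ (B.fn i))] with ω h1 h2
      rw [← h1, smulL, h2]
    refine le_trans (le_of_eq ?_) ((integral_norm_le_norm_Lp_two
      (Y - ∑ i ∈ s, B.smulL P i (ξ (B.fn i)))).trans (Real.le_sqrt_of_sq_le (hYs s)))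
    refine integral_congr_ae ?_
    filter_upwards [h1, Lp.coeFn_sub Y (∑ i ∈ s, B.smulL P i (ξ (B.fn i))),
      Lp.coeFn_finsetSum s (fun i => B.smulL P i (ξ (B.fn i)))] with ω ha hb hc
    rw [hb, Pi.sub_apply, hc, Finset.sum_apply]
    congr 2
    exact (Finset.sum_congr rfl fun i hi => ha ⟨i, hi⟩).symm

/-! ### Convergence in law from convergence of variances -/

theorem abs_integral_lipschitz_sub_le {V Ω : Type*} [NormedAddCommGroup V] [MeasurableSpace Ω]
    {P : Measure Ω} [IsProbabilityMeasure P] {f : V → ℝ} {L : ℝ≥0} (hL : LipschitzWith L f)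
    (hfb : ∃ C : ℝ, ∀ x y, dist (f x) (f y) ≤ C) {U U' : Ω → V} (hU : Integrable U P)
    (hU' : Integrable U' P) :
    |∫ ω, f (U ω) ∂P - ∫ ω, f (U' ω) ∂P| ≤ L * ∫ ω, ‖U ω - U' ω‖ ∂P := by
  obtain ⟨C, hC⟩ := hfb
  have hi : ∀ {U : Ω → V}, Integrable U P → Integrable (fun ω => f (U ω)) P := fun {U} hU => by
    refine Integrable.of_bound (hL.continuous.comp_aestronglyMeasurable hU.1) (|f 0| + C)
      (ae_of_all _ fun ω => ?_)
    have h := hC (U ω) 0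
    rw [Real.dist_eq] at h
    have := abs_sub_abs_le_abs_sub (f (U ω)) (f 0)
    rw [Real.norm_eq_abs]
    linarith
  rw [← integral_sub (hi hU) (hi hU'), ← integral_const_mul]
  refine abs_integral_le_integral_abs.trans (integral_mono ((hi hU).sub (hi hU')).abs
    ((hU.sub hU').norm.const_mul _) fun ω => ?_)
  have := hL.dist_le_mul (U ω) (U' ω)
  rwa [Real.dist_eq, dist_eq_norm] at this

/-- Billingsley's approximation scheme with Lipschitz test functions: if every member of a family
of random vectors is within `ε s` in mean of a random vector converging in law, and `ε s → 0`, then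
the family converges in law. -/
theorem tendsto_integral_of_approx {V κ τ : Type*} [NormedAddCommGroup V] [MeasurableSpace V]
    [BorelSpace V] [SecondCountableTopology V] {l : Filter τ} [l.IsCountablyGenerated]
    {r : Filter κ} [r.NeBot]
    {Ω : τ → Type*} [∀ T, MeasurableSpace (Ω T)] {P : ∀ T, Measure (Ω T)}
    [∀ T, IsProbabilityMeasure (P T)] {Ω' : Type*} [MeasurableSpace Ω'] {P' : Measure Ω'}
    [IsProbabilityMeasure P'] {Y : ∀ T, Ω T → V} {Z : Ω' → V} {Ys : κ → ∀ T, Ω T → V}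
    {Zs : κ → Ω' → V} {ε : κ → ℝ} (hε : Tendsto ε r (nhds 0))
    (hY : ∀ T, Integrable (Y T) (P T)) (hZ : Integrable Z P')
    (hYs : ∀ s T, Integrable (Ys s T) (P T)) (hZs : ∀ s, Integrable (Zs s) P')
    (hYε : ∀ s T, ∫ ω, ‖Y T ω - Ys s T ω‖ ∂(P T) ≤ ε s)
    (hZε : ∀ s, ∫ ω, ‖Z ω - Zs s ω‖ ∂P' ≤ ε s)
    (hlim : ∀ s, TendstoInDistribution (Ys s) l (Zs s) P P') :
    TendstoInDistribution Y l Z P P' where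
  forall_aemeasurable T := (hY T).aemeasurable
  aemeasurable_limit := hZ.aemeasurable
  tendsto := by
    refine tendsto_iff_forall_lipschitz_integral_tendsto.2 ?_
    rintro f hfb ⟨L, hL⟩
    have hm : ∀ {Ω₁ : Type _} [MeasurableSpace Ω₁] {P₁ : Measure Ω₁} {U : Ω₁ → V},
      AEMeasurable U P₁ → ∫ x, f x ∂(P₁.map U) = ∫ ω, f (U ω) ∂P₁ := fun hU =>
      integral_map hU hL.continuous.aestronglyMeasurable
    have hm' : ∀ {U : Ω' → V}, AEMeasurable U P' → ∫ x, f x ∂(P'.map U) = ∫ ω, f (U ω) ∂P' :=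
      fun hU => integral_map hU hL.continuous.aestronglyMeasurable
    have hs : ∀ s, Tendsto (fun T => ∫ ω, f (Ys s T ω) ∂(P T)) l
        (nhds (∫ ω, f (Zs s ω) ∂P')) := fun s => by
      have h := tendsto_iff_forall_lipschitz_integral_tendsto.1 (hlim s).tendsto f hfb ⟨L, hL⟩
      simp only [ProbabilityMeasure.coe_mk] at h
      rw [hm' (hZs s).aemeasurable] at h
      exact h.congr fun T => hm (hYs s T).aemeasurable
    change Tendsto (fun T => ∫ x, f x ∂((P T).map (Y T))) l (nhds (∫ x, f x ∂(P'.map Z)))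
    rw [hm' hZ.aemeasurable]
    refine Tendsto.congr (fun T => (hm (hY T).aemeasurable).symm) ?_
    rw [Metric.tendsto_nhds]
    intro η hη
    have h0 : Tendsto (fun s => L * ε s) r (nhds 0) := by simpa using hε.const_mul (L : ℝ)
    obtain ⟨s, hsη⟩ := (h0.eventually_lt_const (by positivity : 0 < η / 3)).exists
    filter_upwards [Metric.tendsto_nhds.1 (hs s) (η / 3) (by positivity)] with T hT
    rw [Real.dist_eq] at hT ⊢
    have h1 := (abs_integral_lipschitz_sub_le hL hfb (hY T) (hYs s T)).trans
      (mul_le_mul_of_nonneg_left (hYε s T) L.2)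
    have h2 := (abs_integral_lipschitz_sub_le hL hfb hZ (hZs s)).trans
      (mul_le_mul_of_nonneg_left (hZε s) L.2)
    rw [abs_le] at h1 h2
    rw [abs_lt] at hT ⊢
    constructor <;> linarith

theorem integral_exp_of_hasGaussianLaw {Ω : Type*} [MeasurableSpace Ω] {P : Measure Ω}
    {X : Ω → ℝ} (hX : HasGaussianLaw X P) (h0 : ∫ ω, X ω ∂P = 0) :
    ∫ ω, Complex.exp (X ω * Complex.I) ∂P = Complex.exp (-((∫ ω, X ω ^ 2 ∂P : ℝ) : ℂ) / 2) := by
  have := hX.isProbabilityMeasure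
  have h := hX.charFun_map_eq 1
  have e : (fun ω => inner ℝ (1 : ℝ) (X ω)) = X := by ext ω; simp
  rw [e, charFun_apply_real, integral_map hX.aemeasurable (by fun_prop), h0,
    variance_eq_integral hX.aemeasurable, h0] at h
  simpa [neg_div] using h

namespace IsCenteredGaussian

variable {Ω : Type*} [MeasurableSpace Ω] {P : Measure Ω} {W : Ω → SPrime}

theorem memLp_two (hW : IsCenteredGaussian W P) (φ : 𝓢(ℝ, ℝ)) : MemLp (fun ω => W ω φ) 2 P :=
  (hW.gaussian.hasGaussianLaw_eval φ).memLp_two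

theorem integral_exp (hW : IsCenteredGaussian W P) (φ : 𝓢(ℝ, ℝ)) :
    ∫ ω, Complex.exp (W ω φ * Complex.I) ∂P =
      Complex.exp (-((∫ ω, W ω φ ^ 2 ∂P : ℝ) : ℂ) / 2) :=
  integral_exp_of_hasGaussianLaw (hW.gaussian.hasGaussianLaw_eval φ) (hW.centered φ)

/-- The characteristic function of a finite dimensional marginal. -/
theorem charFun_marginal (hW : IsCenteredGaussian W P) {κ : Type*} [Fintype κ]
    (f : κ → 𝓢(ℝ, ℝ)) (t : EuclideanSpace ℝ κ) :
    charFun (P.map fun ω => WithLp.toLp 2 fun i => W ω (f i)) t =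
      Complex.exp (-((∫ ω, W ω (∑ i, t i • f i) ^ 2 ∂P : ℝ) : ℂ) / 2) := by
  rw [charFun_apply, integral_map, ← hW.integral_exp]
  · congr 1
    ext ω
    simp [PiLp.inner_apply, map_sum]
  · exact (WithLp.measurable_toLp 2 _).comp_aemeasurable
      (aemeasurable_pi_lambda _ fun i => (hW.memLp_two (f i)).aestronglyMeasurable.aemeasurable)
  · fun_prop

end IsCenteredGaussian

/-- Finite dimensional marginals of centered Gaussian random distributions converge in law as soon
as the variances converge. -/
theorem tendstoInDistribution_marginal {τ Ω Ω' : Type*} {l : Filter τ} [l.IsCountablyGenerated]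
    [MeasurableSpace Ω] {P : Measure Ω} [IsProbabilityMeasure P]
    [MeasurableSpace Ω'] {P' : Measure Ω'} [IsProbabilityMeasure P']
    {W : τ → Ω → SPrime} {Z : Ω' → SPrime} (hW : ∀ T, IsCenteredGaussian (W T) P)
    (hZ : IsCenteredGaussian Z P')
    (hlim : ∀ φ, Tendsto (fun T => ∫ ω, W T ω φ ^ 2 ∂P) l (nhds (∫ ω, Z ω φ ^ 2 ∂P')))
    {κ : Type*} [Fintype κ] (f : κ → 𝓢(ℝ, ℝ)) :
    TendstoInDistribution (fun T ω => WithLp.toLp 2 fun i => W T ω (f i)) l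
      (fun ω => WithLp.toLp 2 fun i => Z ω (f i)) (fun _ => P) P' where
  forall_aemeasurable T := (WithLp.measurable_toLp 2 _).comp_aemeasurable
    (aemeasurable_pi_lambda _ fun i => ((hW T).memLp_two (f i)).aestronglyMeasurable.aemeasurable)
  aemeasurable_limit := (WithLp.measurable_toLp 2 _).comp_aemeasurable
    (aemeasurable_pi_lambda _ fun i => (hZ.memLp_two (f i)).aestronglyMeasurable.aemeasurable)
  tendsto := by
    refine tendsto_of_seq_tendsto fun x hx => ?_
    refine ProbabilityMeasure.tendsto_of_tendsto_charFun fun t => ?_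
    simp only [ProbabilityMeasure.coe_mk]
    rw [hZ.charFun_marginal f t]
    refine Tendsto.congr (fun n => ((hW (x n)).charFun_marginal f t).symm) ?_
    have h := (hlim (∑ i, t i • f i)).comp hx
    refine (Complex.continuous_exp.tendsto _).comp (Tendsto.div_const (Tendsto.neg ?_) 2)
    exact (Complex.continuous_ofReal.tendsto _).comp h

/-- Convergence in law of centered Gaussian random tempered distributions: it suffices that the
variances of all test functions converge and are dominated by the energy, uniformly along the
family. -/
theorem tendstoInDistribution_of_variance {τ Ω Ω' : Type*} {l : Filter τ} [l.NeBot]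
    [l.IsCountablyGenerated] [MeasurableSpace Ω] {P : Measure Ω} [IsProbabilityMeasure P]
    [MeasurableSpace Ω'] {P' : Measure Ω'} [IsProbabilityMeasure P']
    {W : τ → Ω → SPrime} {Z : Ω' → SPrime} (hW : ∀ T, IsCenteredGaussian (W T) P)
    (hZ : IsCenteredGaussian Z P') {K : ℝ} (hK : 0 ≤ K)
    (hE : ∀ T φ, ∫ ω, W T ω φ ^ 2 ∂P ≤ K * energy φ)
    (hlim : ∀ φ, Tendsto (fun T => ∫ ω, W T ω φ ^ 2 ∂P) l (nhds (∫ ω, Z ω φ ^ 2 ∂P'))) :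
    TendstoInDistribution W l Z (fun _ => P) P' := by
  obtain ⟨ι, ⟨B⟩⟩ := nonempty_schwartzBasis
  have hEZ : ∀ φ, ∫ ω, Z ω φ ^ 2 ∂P' ≤ K * energy φ := fun φ =>
    le_of_tendsto (hlim φ) (Eventually.of_forall fun T => hE T φ)
  choose Y hYm hYW hYs using fun T =>
    B.exists_regularization hK (fun φ => (hW T).memLp_two φ) (hE T)
  obtain ⟨U, hUm, hUZ, hUs⟩ := B.exists_regularization hK (fun φ => hZ.memLp_two φ) hEZ
  have hε : Tendsto (fun s => √(K * B.tail s)) atTop (nhds 0) := by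
    simpa using (B.tendsto_tail.const_mul K).sqrt
  have hY : TendstoInDistribution Y l U (fun _ => P) P' := by
    refine tendsto_integral_of_approx hε (fun T => (hYm T).integrable (by norm_num))
      (hUm.integrable (by norm_num))
      (fun s T => integrable_finsetSum s fun i _ =>
        (((hW T).memLp_two (B.fn i)).integrable (by norm_num)).smul_const (B.basis i))
      (fun s => integrable_finsetSum s fun i _ =>
        ((hZ.memLp_two (B.fn i)).integrable (by norm_num)).smul_const (B.basis i))
      (fun s T => hYs T s) hUs fun s => ?_
    have h := (tendstoInDistribution_marginal hW hZ hlim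
      (fun i : s => B.fn i)).continuous_comp
      (g := fun x : EuclideanSpace ℝ s => ∑ i : s, x i • B.basis i) (by fun_prop)
    have e : ∀ z : SPrime, ∑ i : s, z (B.fn i) • B.basis i = ∑ i ∈ s, z (B.fn i) • B.basis i :=
      fun z => Finset.sum_coe_sort s fun i => z (B.fn i) • B.basis i
    simpa only [Function.comp_def, e] using h
  exact (hY.continuous_comp toDistribution.continuous).congr (fun T => (hYW T).symm) hUZ.symm

/-! ### Existence of Gaussian random distributions -/

theorem norm_exp_mul_I_sub_le (a b : ℝ) :
    ‖Complex.exp (a * Complex.I) - Complex.exp (b * Complex.I)‖ ≤ |a - b| := by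
  have h : Complex.exp (a * Complex.I) - Complex.exp (b * Complex.I) =
      Complex.exp (b * Complex.I) * (Complex.exp (Complex.I * ((a - b : ℝ) : ℂ)) - 1) := by
    rw [mul_sub, ← Complex.exp_add, mul_one]
    congr 2
    push_cast
    ring
  rw [h, norm_mul, Complex.norm_exp_ofReal_mul_I, one_mul]
  exact Real.norm_exp_I_mul_ofReal_sub_one_le

theorem integral_Lp_sq {Ω : Type*} [MeasurableSpace Ω] {P : Measure Ω} (X : Lp ℝ 2 P) :
    ∫ ω, X ω ^ 2 ∂P = ‖X‖ ^ 2 := by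
  rw [← real_inner_self_eq_norm_sq, L2.inner_def]
  simp [sq]

/-- Centered Gaussian random variables form a closed subset of `L²`: characteristic functions pass
to the limit. -/
theorem hasGaussianLaw_of_tendsto_Lp {Ω κ : Type*} [MeasurableSpace Ω] {P : Measure Ω}
    [IsProbabilityMeasure P] {r : Filter κ} [r.NeBot] {X : Lp ℝ 2 P} {Xs : κ → Lp ℝ 2 P}
    (hX : Tendsto Xs r (nhds X)) (hG : ∀ s, HasGaussianLaw (Xs s) P)
    (h0 : ∀ s, ∫ ω, Xs s ω ∂P = 0) : HasGaussianLaw X P ∧ ∫ ω, X ω ∂P = 0 := by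
  have hi : ∀ Z : Lp ℝ 2 P, Integrable Z P := fun Z => (Lp.memLp Z).integrable (by norm_num)
  have hL1 : Tendsto (fun s => ∫ ω, |Xs s ω - X ω| ∂P) r (nhds 0) := by
    refine squeeze_zero (fun s => integral_nonneg fun ω => abs_nonneg _) (fun s => ?_)
      (tendsto_iff_norm_sub_tendsto_zero.1 hX)
    refine le_trans (le_of_eq (integral_congr_ae ?_)) (integral_norm_le_norm_Lp_two (Xs s - X))
    filter_upwards [Lp.coeFn_sub (Xs s) X] with ω hω
    rw [hω]
    rfl
  constructor
  · have hchar : ∀ t : ℝ, ∫ ω, Complex.exp ((t * X ω : ℝ) * Complex.I) ∂P =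
        Complex.exp (-((t ^ 2 * ‖X‖ ^ 2 : ℝ) : ℂ) / 2) := by
      intro t
      have hexp : ∀ Z : Lp ℝ 2 P,
          Integrable (fun ω => Complex.exp ((t * Z ω : ℝ) * Complex.I)) P := fun Z => by
        refine Integrable.of_bound ?_ 1 (ae_of_all _ fun ω => ?_)
        · exact (by fun_prop : Continuous fun x : ℝ =>
            Complex.exp ((t * x : ℝ) * Complex.I)).comp_aestronglyMeasurable
            (Lp.aestronglyMeasurable Z)
        · rw [Complex.norm_exp_ofReal_mul_I]
      have h1 : Tendsto (fun s => ∫ ω, Complex.exp ((t * Xs s ω : ℝ) * Complex.I) ∂P) r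
          (nhds (∫ ω, Complex.exp ((t * X ω : ℝ) * Complex.I) ∂P)) := by
        rw [tendsto_iff_norm_sub_tendsto_zero]
        refine squeeze_zero (fun s => norm_nonneg _) (fun s => ?_)
          (by simpa using hL1.const_mul |t| :
            Tendsto (fun s => |t| * ∫ ω, |Xs s ω - X ω| ∂P) r (nhds 0))
        rw [← integral_sub (hexp _) (hexp _), ← integral_const_mul]
        refine (norm_integral_le_integral_norm _).trans (integral_mono
          ((hexp _).sub (hexp _)).norm (((hi _).sub (hi _)).abs.const_mul _) fun ω => ?_)
        refine (norm_exp_mul_I_sub_le _ _).trans (le_of_eq ?_)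
        rw [← mul_sub, abs_mul]
      refine tendsto_nhds_unique h1 ?_
      have h2 : ∀ s, ∫ ω, Complex.exp ((t * Xs s ω : ℝ) * Complex.I) ∂P =
          Complex.exp (-((t ^ 2 * ‖Xs s‖ ^ 2 : ℝ) : ℂ) / 2) := fun s => by
        rw [integral_exp_of_hasGaussianLaw (X := fun ω => t * Xs s ω) ((hG s).fun_smul t)
          (by rw [integral_const_mul, h0, mul_zero])]
        simp_rw [mul_pow]
        rw [integral_const_mul, integral_Lp_sq]
      simp_rw [h2]
      refine (Complex.continuous_exp.tendsto _).comp (Tendsto.div_const (Tendsto.neg ?_) 2)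
      exact (Complex.continuous_ofReal.tendsto _).comp ((hX.norm.pow 2).const_mul (t ^ 2))
    have hXm := (Lp.aestronglyMeasurable X).aemeasurable
    have hmap : P.map X = gaussianReal 0 (‖X‖ ^ 2).toNNReal := by
      have := Measure.isProbabilityMeasure_map hXm
      refine Measure.ext_of_charFun (funext fun t => ?_)
      rw [charFun_gaussianReal, charFun_apply_real, integral_map hXm (by fun_prop)]
      have := hchar t
      push_cast at this
      rw [this, Real.coe_toNNReal _ (by positivity)]
      congr 1
      push_cast
      ring
    exact ⟨by rw [hmap]; infer_instance⟩
  · refine tendsto_nhds_unique (f := fun s => ∫ ω, Xs s ω ∂P) (l := r) ?_ (by simp [h0])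
    rw [tendsto_iff_norm_sub_tendsto_zero]
    refine squeeze_zero (fun s => norm_nonneg _) (fun s => ?_) hL1
    rw [← integral_sub (hi _) (hi _)]
    exact norm_integral_le_integral_norm _

/-- Existence of the isonormal Gaussian process over a real Hilbert space: a linear isometry into
`L²` with centered Gaussian values. -/
theorem exists_isonormal.{u} (H : Type u) [NormedAddCommGroup H] [InnerProductSpace ℝ H]
    [CompleteSpace H] :
    ∃ (Ω : Type u) (_ : MeasurableSpace Ω) (P : Measure Ω) (_ : IsProbabilityMeasure P)
      (L : H →ₗᵢ[ℝ] Lp ℝ 2 P), ∀ h, HasGaussianLaw (L h) P ∧ ∫ ω, L h ω ∂P = 0 := by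
  obtain ⟨w, b, -⟩ := exists_hilbertBasis ℝ H
  obtain ⟨Ω, mΩ, P, X, hXm, hXl, hXi, hP⟩ := exists_iid w (gaussianReal 0 1)
  have hG : ∀ i, HasGaussianLaw (X i) P := fun i => (hXl i).hasGaussianLaw
  have hX2 : ∀ i, MemLp (X i) 2 P := fun i => (hG i).memLp_two
  have hX0 : ∀ i, ∫ ω, X i ω ∂P = 0 := fun i => by
    rw [(hXl i).integral_eq, integral_id_gaussianReal]
  have hXv : ∀ i, ∫ ω, X i ω ^ 2 ∂P = 1 := fun i => by
    have h := (hXl i).variance_eq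
    rw [variance_eq_integral (hXm i).aemeasurable, hX0, variance_id_gaussianReal] at h
    simpa using h
  have hon : Orthonormal ℝ fun i => (hX2 i).toLp (X i) := by
    constructor
    · intro i
      rw [← sq_eq_sq₀ (norm_nonneg _) zero_le_one, norm_toLp_two_sq, hXv, one_pow]
    · intro i j hij
      rw [L2.inner_def]
      have h := (hXi.indepFun hij).integral_fun_mul_eq_mul_integral
        (hX2 i).aestronglyMeasurable (hX2 j).aestronglyMeasurable
      rw [hX0, zero_mul] at h
      rw [← h]
      refine integral_congr_ae ?_
      filter_upwards [(hX2 i).coeFn_toLp, (hX2 j).coeFn_toLp] with ω h1 h2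
      simp [h1, h2, mul_comm]
  refine ⟨Ω, mΩ, P, hP, hon.orthogonalFamily.linearIsometry.comp b.repr.toLinearIsometry,
    fun h => ?_⟩
  obtain ⟨c, hc⟩ : ∃ c : w → ℝ, ∀ i, b.repr h i = c i := ⟨_, fun _ => rfl⟩
  have hs : Tendsto (fun s : Finset w => ∑ i ∈ s, c i • (hX2 i).toLp (X i)) atTop
      (nhds (hon.orthogonalFamily.linearIsometry (b.repr h))) := by
    have hs := hon.orthogonalFamily.hasSum_linearIsometry (b.repr h)
    simpa only [HasSum, SummationFilter.unconditional_filter,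
      LinearIsometry.toSpanSingleton_apply, hc] using hs
  have hae : ∀ s : Finset w, ((∑ i ∈ s, c i • (hX2 i).toLp (X i) : Lp ℝ 2 P) : Ω → ℝ) =ᵐ[P]
      fun ω => ∑ i : s, c i * X i ω := by
    intro s
    have h1 : ∀ᵐ ω ∂P, ∀ i : s, (c i • (hX2 i).toLp (X i) : Lp ℝ 2 P) ω = c i * X i ω := by
      rw [ae_all_iff]
      intro i
      filter_upwards [Lp.coeFn_smul (c i) ((hX2 i).toLp (X i)), (hX2 i).coeFn_toLp]
        with ω ha hb
      rw [ha, Pi.smul_apply, hb, smul_eq_mul]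
    filter_upwards [h1, Lp.coeFn_finsetSum s fun i => (c i • (hX2 i).toLp (X i) : Lp ℝ 2 P)]
      with ω ha hb
    rw [hb, Finset.sum_apply, ← Finset.sum_coe_sort]
    exact Finset.sum_congr rfl fun i _ => ha i
  refine hasGaussianLaw_of_tendsto_Lp (r := atTop) hs (fun s => ?_) fun s => ?_
  · refine HasGaussianLaw.congr ?_ (hae s).symm
    have hind : iIndepFun (fun (i : s) ω => c i * X i ω) P :=
      (hXi.precomp Subtype.val_injective).comp (fun (i : s) x => c i * x)
        fun i => measurable_const_mul _
    exact hind.hasGaussianLaw_fun_sum fun i => (hG i).fun_smul (c i)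
  · rw [integral_congr_ae (hae s), integral_finsetSum Finset.univ fun (i : s) _ =>
      ((hX2 i).integrable (by norm_num)).const_mul (c i)]
    exact Finset.sum_eq_zero fun i _ => by rw [integral_const_mul, hX0, mul_zero]

/-- A Gaussian law on `𝓢'` whose covariance is the inner product of a Hilbert space, pulled back
along a linear map that is continuous for the energy norm. -/
theorem exists_isCenteredGaussian {H : Type} [NormedAddCommGroup H] [InnerProductSpace ℝ H]
    [CompleteSpace H] (J : 𝓢(ℝ, ℝ) →ₗ[ℝ] H) {K : ℝ} (hK : 0 ≤ K)
    (hJ : ∀ φ, ‖J φ‖ ^ 2 ≤ K * energy φ) :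
    ∃ Q : Measure SPrime, IsProbabilityMeasure Q ∧ IsCenteredGaussian id Q ∧
      ∀ φ ψ : 𝓢(ℝ, ℝ), ∫ z, z φ * z ψ ∂Q = inner ℝ (J φ) (J ψ) := by
  obtain ⟨Ω, mΩ, P, hP, L, hL⟩ := exists_isonormal H
  obtain ⟨ι, ⟨B⟩⟩ := nonempty_schwartzBasis
  obtain ⟨Y, hY, -⟩ := B.exists_realization P (L.toLinearMap ∘ₗ J) hK fun φ => by
    simpa using hJ φ
  have hm : AEMeasurable (fun ω => toDistribution (Y ω)) P :=
    toDistribution.continuous.measurable.comp_aemeasurable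
      (Lp.aestronglyMeasurable Y).aemeasurable
  have heval : ∀ φ : 𝓢(ℝ, ℝ), Continuous fun z : SPrime => z φ := fun φ => by
    simpa using (ContinuousEvalConst.continuous_eval_const φ :
      Continuous fun z : 𝓢(ℝ, ℝ) →L[ℝ] ℝ => z φ)
  have hae : ∀ φ, (fun ω => toDistribution (Y ω) φ) =ᵐ[P] L (J φ) := fun φ => by
    filter_upwards [hY φ] with ω hω
    rw [toDistribution_apply, hω]
    rfl
  have hG : ∀ φ, IsGaussian ((P.map fun ω => toDistribution (Y ω)).map fun z => z φ) := fun φ => by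
    rw [AEMeasurable.map_map_of_aemeasurable (heval φ).measurable.aemeasurable hm]
    exact ((hL (J φ)).1.congr (hae φ).symm).isGaussian_map
  -- a linear form of finitely many evaluations is the evaluation at a linear combination
  refine ⟨P.map fun ω => toDistribution (Y ω), Measure.isProbabilityMeasure_map hm,
    ⟨measurable_id, ⟨fun I => ⟨isGaussian_of_isGaussian_map fun l => ?_⟩⟩, fun φ => ?_⟩,
    fun φ ψ => ?_⟩
  · classical
    have hr : Measurable fun (z : SPrime) => I.restrict fun φ => id z φ :=
      measurable_pi_lambda _ fun φ => (heval φ).measurable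
    rw [Measure.map_map l.continuous.measurable hr]
    convert hG (∑ φ : I, l (Pi.single φ 1) • (φ : 𝓢(ℝ, ℝ))) using 2
    ext z
    have h := l.toLinearMap.pi_apply_eq_sum_univ (I.restrict fun φ => z φ)
    have e : ∀ i : I, (Pi.single i 1 : I → ℝ) = fun j => if i = j then 1 else 0 := fun i => by
      ext j
      simp [Pi.single_apply, eq_comm]
    simpa [e, mul_comm] using h
  · simp only [id_eq]
    rw [integral_map hm (heval φ).aestronglyMeasurable, ← (hL (J φ)).2]
    exact integral_congr_ae (hae φ)
  · rw [integral_map hm (f := fun z : SPrime => z φ * z ψ)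
      ((heval φ).mul (heval ψ)).aestronglyMeasurable, ← L.inner_map_map, L2.inner_def]
    refine integral_congr_ae ?_
    filter_upwards [hae φ, hae ψ] with ω h1 h2
    simp [h1, h2, mul_comm]

section Fourier

open scoped FourierTransform ContDiff

/-! ### Plancherel's theorem and the stable semigroup -/

theorem integral_norm_sq_eq_norm_Lp {f : ℝ → ℂ} (hf : MemLp f 2 volume) :
    ∫ x, ‖f x‖ ^ 2 = ‖hf.toLp f‖ ^ 2 := by
  rw [Lp.norm_toLp, hf.eLpNorm_eq_integral_rpow_norm (by norm_num) (by norm_num),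
    ENNReal.toReal_ofReal (by positivity), ← Real.rpow_natCast,
    ← Real.rpow_mul (integral_nonneg fun x => by positivity)]
  simp

/-- Plancherel's theorem for the inverse Fourier integral on `L¹ ∩ L²`. -/
theorem integral_norm_sq_fourierInv {h : ℝ → ℂ} (h1 : Integrable h) (h2 : MemLp h 2 volume) :
    MemLp (𝓕⁻ h) 2 volume ∧ ∫ x, ‖𝓕⁻ h x‖ ^ 2 = ∫ x, ‖h x‖ ^ 2 := by
  set u : Lp ℂ 2 (volume : Measure ℝ) := 𝓕⁻ (h2.toLp h) with hu
  have hL : Continuous fun p : ℝ × ℝ => (-innerₗ ℝ : ℝ →ₗ[ℝ] ℝ →ₗ[ℝ] ℝ) p.1 p.2 := by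
    simp only [LinearMap.neg_apply, innerₗ_apply_apply]
    fun_prop
  have hc : Continuous (𝓕⁻ h) := by
    have := VectorFourier.fourierIntegral_continuous (E := ℂ) (μ := volume) (f := h)
      Real.continuous_fourierChar (L := -innerₗ ℝ) hL h1
    exact this
  -- the `L²` transform `u` and the Fourier integral have the same pairing with test functions
  have hae : ∀ᵐ x, u x = 𝓕⁻ h x := by
    refine ae_eq_of_integral_contDiff_smul_eq ((Lp.memLp u).locallyIntegrable (by norm_num))
      hc.locallyIntegrable fun g hg hgs => ?_
    have hg₁ : HasCompactSupport (Complex.ofRealCLM ∘ g) := hgs.comp_left rfl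
    have hg₂ : ContDiff ℝ ∞ (Complex.ofRealCLM ∘ g) := by fun_prop
    set G : 𝓢(ℝ, ℂ) := hg₁.toSchwartzMap hg₂ with hG
    have e1 : ∫ x, G x • u x = ∫ x, (𝓕⁻ G) x • h x := by
      rw [← Lp.toTemperedDistribution_apply, hu, ← Lp.fourierInv_toTemperedDistribution_eq,
        TemperedDistribution.fourierInv_apply, Lp.toTemperedDistribution_apply]
      refine integral_congr_ae ?_
      filter_upwards [h2.coeFn_toLp] with x hx
      rw [hx]
    have e2 : ∫ x, 𝓕⁻ h x • G x = ∫ x, h x • (𝓕⁻ G) x := by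
      have := VectorFourier.integral_fourierIntegral_smul_eq_flip (μ := volume) (ν := volume)
        (L := -innerₗ ℝ) (e := Real.fourierChar) Real.continuous_fourierChar hL h1 G.integrable
      have hf : (-innerₗ ℝ : ℝ →ₗ[ℝ] ℝ →ₗ[ℝ] ℝ).flip = -innerₗ ℝ := by
        ext
        simp
      rw [hf] at this
      rw [SchwartzMap.fourierInv_coe]
      exact this
    have e3 : ∀ x, G x = g x := fun x => rfl
    simp only [smul_eq_mul, e3] at e1 e2
    simp only [Complex.real_smul]
    rw [e1]
    simp_rw [mul_comm] at e2 ⊢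
    exact e2.symm
  have hm : MemLp (𝓕⁻ h) 2 volume := (memLp_congr_ae hae).1 (Lp.memLp u)
  refine ⟨hm, ?_⟩
  rw [integral_norm_sq_eq_norm_Lp hm, integral_norm_sq_eq_norm_Lp h2]
  have e : hm.toLp _ = u := by
    rw [← Lp.toLp_coeFn u (Lp.memLp u)]
    exact MemLp.toLp_eq_toLp_iff _ _ |>.2 (Filter.EventuallyEq.symm hae)
  rw [e, hu, ← Lp.norm_fourier_eq, FourierTransform.fourier_fourierInv_eq]

/-- The Fourier transform, in the normalization `∫ e^{-2πixη} φ(x) dx`, of a real Schwartz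
function. -/
def fourierR : 𝓢(ℝ, ℝ) →ₗ[ℝ] 𝓢(ℝ, ℂ) where
  toFun φ := 𝓕 (SchwartzMap.postcompCLM Complex.ofRealCLM φ)
  map_add' φ ψ := by rw [map_add, FourierAdd.fourier_add]
  map_smul' c φ := by
    rw [map_smul]
    exact (SchwartzMap.fourierTransformCLM ℝ (V := ℝ) (E := ℂ)).map_smul c _

theorem fourierR_eq (φ : 𝓢(ℝ, ℝ)) (η : ℝ) : fourierR φ η = 𝓕 (fun x => (φ x : ℂ)) η := rfl

theorem integral_norm_sq_fourierR (φ : 𝓢(ℝ, ℝ)) : ∫ η, ‖fourierR φ η‖ ^ 2 = ∫ x, φ x ^ 2 := by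
  refine (SchwartzMap.integral_norm_sq_fourier _).trans ?_
  simp

theorem integrable_norm_sq_fourierR (φ : 𝓢(ℝ, ℝ)) : Integrable fun η => ‖fourierR φ η‖ ^ 2 :=
  (((fourierR φ).memLp 2).integrable_norm_pow (by norm_num))

theorem fourierR_deriv (φ : 𝓢(ℝ, ℝ)) (η : ℝ) :
    fourierR (SchwartzMap.derivCLM ℝ ℝ φ) η = 2 * Real.pi * Complex.I * η * fourierR φ η := by
  set f : 𝓢(ℝ, ℂ) := SchwartzMap.postcompCLM Complex.ofRealCLM φ
  set g : 𝓢(ℝ, ℂ) := SchwartzMap.postcompCLM Complex.ofRealCLM (SchwartzMap.derivCLM ℝ ℝ φ)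
  have hd : deriv f = g := by
    ext x
    exact (HasDerivAt.ofReal_comp (φ.differentiable x).hasDerivAt).deriv
  have h := Real.fourier_deriv f.integrable f.differentiable (hd ▸ g.integrable)
  have h' := congrFun h η
  rw [hd] at h'
  exact h'

/-- The energy in Fourier coordinates. -/
theorem energy_eq (φ : 𝓢(ℝ, ℝ)) :
    Integrable (fun η => ‖fourierR φ η‖ ^ 2 * (1 + (2 * Real.pi * η) ^ 2)) ∧
    energy φ = ∫ η, ‖fourierR φ η‖ ^ 2 * (1 + (2 * Real.pi * η) ^ 2) := by
  have e : ∀ η, ‖fourierR φ η‖ ^ 2 * (1 + (2 * Real.pi * η) ^ 2) =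
      ‖fourierR φ η‖ ^ 2 + ‖fourierR (SchwartzMap.derivCLM ℝ ℝ φ) η‖ ^ 2 := fun η => by
    rw [fourierR_deriv]
    simp only [norm_mul, Complex.norm_ofNat, Complex.norm_real, Complex.norm_I, Real.norm_eq_abs,
      mul_pow, sq_abs]
    ring
  have h1 := integrable_norm_sq_fourierR φ
  have h2 := integrable_norm_sq_fourierR (SchwartzMap.derivCLM ℝ ℝ φ)
  simp_rw [e]
  refine ⟨h1.add h2, ?_⟩
  rw [integral_add h1 h2, integral_norm_sq_fourierR, integral_norm_sq_fourierR,
    ← integral_add (integrable_sq φ) (integrable_sq _)]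
  rfl

variable {α : ℝ}

/-- The Fourier multiplier of `𝒯_1`, in the normalization of `fourierR`. -/
def symbol (α η : ℝ) : ℝ := Real.exp (-|2 * Real.pi * η| ^ α)

theorem symbol_nonneg (η : ℝ) : 0 ≤ symbol α η := (Real.exp_pos _).le

theorem symbol_le_one (η : ℝ) : symbol α η ≤ 1 :=
  Real.exp_le_one_iff.2 (neg_nonpos.2 (by positivity))

theorem continuous_symbol (hα : 0 < α) : Continuous (symbol α) := by
  unfold symbol
  have : Continuous fun η : ℝ => |2 * Real.pi * η| ^ α :=
    (Real.continuous_rpow_const hα.le).comp (by fun_prop)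
  fun_prop

theorem integrable_symbol (hα : 0 < α) : Integrable (symbol α) := by
  have h : Integrable fun x : ℝ => Real.exp (-|x| ^ α) := by
    -- the integral is a positive value of the Gamma function, so it is not the junk value `0`
    refine not_imp_comm.1 integral_undef (ne_of_gt ?_)
    rw [integral_comp_abs (f := fun x => Real.exp (-x ^ α)), integral_exp_neg_rpow hα]
    exact mul_pos two_pos (Real.Gamma_pos_of_pos (by positivity))
  exact h.comp_mul_left' (by positivity)

theorem integrable_exp_mul_symbol (hα : 0 < α) (x : ℝ) : Integrable fun η : ℝ =>
    Complex.exp (((2 * Real.pi * inner ℝ η x : ℝ) : ℂ) * Complex.I) * (symbol α η : ℂ) := by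
  refine (integrable_symbol hα).mono' (Continuous.aestronglyMeasurable ?_)
    (ae_of_all _ fun η => ?_)
  · have := continuous_symbol hα
    fun_prop
  · rw [norm_mul, Complex.norm_exp_ofReal_mul_I, one_mul, Complex.norm_real,
      Real.norm_of_nonneg (symbol_nonneg η)]

/-- A Hermitian function has a real integral. -/
theorem integral_eq_ofReal_of_conj {f : ℝ → ℂ} (hf : Integrable f)
    (h : ∀ x, f (-x) = (starRingEnd ℂ) (f x)) : ∫ x, f x = ((∫ x, (f x).re : ℝ) : ℂ) := by
  have h1 : (starRingEnd ℂ) (∫ x, f x) = ∫ x, f x := by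
    rw [← integral_conj, ← integral_neg_eq_self f]
    exact integral_congr_ae (ae_of_all _ fun x => (h x).symm)
  rw [← Complex.conj_eq_iff_re.1 h1]
  congr 1
  exact (integral_re hf).symm

/-- The stable density is the inverse Fourier transform of its characteristic function. -/
theorem stableDensity_eq_fourierInv (hα : 0 < α) (x : ℝ) :
    (stableDensity α 1 x : ℂ) = 𝓕⁻ (fun η => (symbol α η : ℂ)) x := by
  have hi := integrable_exp_mul_symbol hα x
  rw [Real.fourierInv_eq']
  simp only [smul_eq_mul]
  rw [integral_eq_ofReal_of_conj hi]
  · congr 1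
    have h := Measure.integral_comp_mul_left
      (fun ξ => Real.cos (x * ξ) * Real.exp (-|ξ| ^ α)) (2 * Real.pi)
    rw [abs_of_pos (by positivity), smul_eq_mul] at h
    simp only [stableDensity, one_mul]
    rw [← h]
    refine integral_congr_ae (ae_of_all _ fun η => ?_)
    simp only [Complex.re_mul_ofReal, Complex.exp_ofReal_mul_I_re, symbol]
    congr 2
    simp
    ring
  · intro η
    have e : symbol α (-η) = symbol α η := by simp [symbol]
    simp [e, ← Complex.exp_conj, Complex.conj_ofNat]

/-- `𝒯_1` is the Fourier multiplier with symbol `symbol α`. -/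
theorem stableSemigroup_one_eq (hα : 0 < α) (φ : 𝓢(ℝ, ℝ)) (x : ℝ) :
    (stableSemigroup α 1 φ x : ℂ) = 𝓕⁻ (fun η => symbol α η * fourierR φ η) x := by
  set f : ℝ → ℂ := fun η =>
    Complex.exp (((2 * Real.pi * inner ℝ η x : ℝ) : ℂ) * Complex.I) * (symbol α η : ℂ) with hf
  have hi : Integrable f := integrable_exp_mul_symbol hα x
  have hF : ∀ y, 𝓕 f y = stableDensity α 1 (x - y) := fun y => by
    rw [stableDensity_eq_fourierInv hα, Real.fourierInv_eq', Real.fourier_eq']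
    refine integral_congr_ae (ae_of_all _ fun η => ?_)
    simp only [hf, smul_eq_mul]
    rw [← mul_assoc, ← Complex.exp_add]
    congr 2
    simp
    ring
  -- `y ↦ p_1(x - y)` is the Fourier transform of `f`, which is moved onto `φ` by Fubini
  have h := VectorFourier.integral_fourierIntegral_smul_eq_flip (μ := volume) (ν := volume)
    (L := innerₗ ℝ) (e := Real.fourierChar) Real.continuous_fourierChar continuous_inner hi
    (g := fun y => (φ y : ℂ)) (φ.integrable.ofReal)
  rw [flip_innerₗ] at h
  have h' : ∫ y, 𝓕 f y • (φ y : ℂ) = ∫ η, f η • fourierR φ η := h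
  simp only [stableSemigroup, one_ne_zero, if_false, NNReal.coe_one]
  rw [← integral_complex_ofReal, Real.fourierInv_eq']
  simp_rw [hF] at h'
  push_cast
  refine h'.trans (integral_congr_ae (ae_of_all _ fun η => ?_))
  simp [hf, mul_assoc]

theorem integral_stableSemigroup_one_sq (hα : 0 < α) (φ : 𝓢(ℝ, ℝ)) :
    ∫ x, stableSemigroup α 1 φ x ^ 2 = ∫ η, symbol α η ^ 2 * ‖fourierR φ η‖ ^ 2 := by
  have hle : ∀ η, ‖(symbol α η : ℂ) * fourierR φ η‖ ≤ ‖fourierR φ η‖ := fun η => by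
    rw [norm_mul, Complex.norm_real, Real.norm_of_nonneg (symbol_nonneg η)]
    exact mul_le_of_le_one_left (norm_nonneg _) (symbol_le_one η)
  have hm : AEStronglyMeasurable (fun η => (symbol α η : ℂ) * fourierR φ η) volume :=
    ((Complex.continuous_ofReal.comp (continuous_symbol hα)).mul
      (fourierR φ).continuous).aestronglyMeasurable
  have h := (integral_norm_sq_fourierInv ((fourierR φ).integrable.mono hm (ae_of_all _ hle))
    (((fourierR φ).memLp 2).mono hm (ae_of_all _ hle))).2
  simp_rw [← stableSemigroup_one_eq hα] at h
  simpa [mul_pow] using h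

theorem fourierR_scale {T : ℝ} (hT : 0 < T) (φ : 𝓢(ℝ, ℝ)) (η : ℝ) :
    fourierR (scale T φ) η = T * fourierR φ (T * η) := by
  simp only [fourierR_eq, Real.fourier_eq']
  have h := Measure.integral_comp_mul_left (fun x => Complex.exp
    (((-2 * Real.pi * inner ℝ x η : ℝ) : ℂ) * Complex.I) • (scale T φ x : ℂ)) T
  rw [abs_of_pos (by positivity), eq_inv_smul_iff₀ hT.ne'] at h
  rw [← h, Complex.real_smul]
  congr 1
  refine integral_congr_ae (ae_of_all _ fun x => ?_)
  simp only [scale_apply hT.ne', mul_div_cancel_left₀ x hT.ne']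
  congr 3
  simp
  ring

end Fourier

variable {α : ℝ}

/-! ### Variance of the rescaled process -/

theorem fourierHat_eq_fourierR (φ : 𝓢(ℝ, ℝ)) (x : ℝ) :
    fourierHat φ x = fourierR φ (-x / (2 * Real.pi)) := by
  rw [fourierR_eq, Real.fourier_eq', fourierHat]
  refine integral_congr_ae (ae_of_all _ fun y => ?_)
  simp only [smul_eq_mul]
  congr 2
  have : (Real.pi : ℂ) ≠ 0 := by exact_mod_cast Real.pi_ne_zero
  simp
  field_simp

/-- The change of variables `x = -2πη` between the two normalizations of the Fourier transform. -/
theorem integral_comp_neg_div_two_pi {E : Type*} [NormedAddCommGroup E] [NormedSpace ℝ E]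
    (g : ℝ → E) : ∫ x, g (-x / (2 * Real.pi)) = (2 * Real.pi) • ∫ η, g η := by
  have h := Measure.integral_comp_mul_left g (-(2 * Real.pi)⁻¹)
  rw [inv_neg, inv_inv, abs_neg, abs_of_pos (by positivity)] at h
  rw [← h]
  refine integral_congr_ae (ae_of_all _ fun x => ?_)
  change g _ = g _
  congr 1
  ring

theorem integral_scale_sq {T : ℝ} (hT : 0 < T) (φ : 𝓢(ℝ, ℝ)) (w : ℝ → ℝ) :
    ∫ η, w η * ‖fourierR (scale T φ) η‖ ^ 2 = T * ∫ η, w (η / T) * ‖fourierR φ η‖ ^ 2 := by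
  have h := Measure.integral_comp_mul_left (fun η => w (η / T) * ‖fourierR φ η‖ ^ 2) T
  rw [abs_of_pos (by positivity), smul_eq_mul, eq_inv_mul_iff_mul_eq₀ hT.ne'] at h
  rw [← h, ← mul_assoc, ← integral_const_mul]
  refine integral_congr_ae (ae_of_all _ fun η => ?_)
  simp only [fourierR_scale hT, mul_div_cancel_left₀ η hT.ne', norm_mul, Complex.norm_real,
    Real.norm_of_nonneg hT.le]
  ring

theorem integrable_symbol_sq_mul (hα : 0 < α) (φ : 𝓢(ℝ, ℝ)) (T : ℝ) :
    Integrable fun η => symbol α (η / T) ^ 2 * ‖fourierR φ η‖ ^ 2 := by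
  refine (integrable_norm_sq_fourierR φ).mono' (Continuous.aestronglyMeasurable ?_)
    (ae_of_all _ fun η => ?_)
  · have := continuous_symbol hα
    have := (fourierR φ).continuous
    fun_prop
  · rw [Real.norm_of_nonneg (by positivity)]
    exact mul_le_of_le_one_left (by positivity)
      (pow_le_one₀ (symbol_nonneg _) (symbol_le_one _))

/-- The variance of the rescaled process, in Fourier coordinates. -/
theorem IsDensityProcess.integral_rescaled_sq {Ω : Type*} [MeasurableSpace Ω] {P : Measure Ω}
    {m v : ℝ} {X : ℝ≥0 → Ω → SPrime} (hX : IsDensityProcess α m v X P) (hα : 0 < α)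
    (F : ℝ → ℝ) {T : ℝ} (hT : 0 < T) (φ : 𝓢(ℝ, ℝ)) :
    ∫ ω, rescaled F X T ω φ ^ 2 ∂P = (F T ^ 2)⁻¹ * T *
      ∫ η, (m + (v - m) * symbol α (η / T) ^ 2) * ‖fourierR φ η‖ ^ 2 := by
  have h := hX.covariance 1 1 (scale T φ) (scale T φ)
  simp only [nndist_self, ← sq] at h
  have e0 : ∫ x, scale T φ x * stableSemigroup α 0 (scale T φ) x =
      T * ∫ η, ‖fourierR φ η‖ ^ 2 := by
    have := integral_scale_sq hT φ fun _ => 1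
    simp only [one_mul] at this
    rw [← this, integral_norm_sq_fourierR]
    simp [stableSemigroup, sq]
  rw [e0, integral_stableSemigroup_one_sq hα, integral_scale_sq hT φ fun η => symbol α η ^ 2] at h
  have e1 : ∀ ω, rescaled F X T ω φ ^ 2 = (F T ^ 2)⁻¹ * X 1 ω (scale T φ) ^ 2 := fun ω => by
    simp [rescaled, mul_pow]
  have e2 : ∫ η, (m + (v - m) * symbol α (η / T) ^ 2) * ‖fourierR φ η‖ ^ 2 =
      m * (∫ η, ‖fourierR φ η‖ ^ 2) +
        (v - m) * ∫ η, symbol α (η / T) ^ 2 * ‖fourierR φ η‖ ^ 2 := by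
    rw [← integral_const_mul, ← integral_const_mul,
      ← integral_add ((integrable_norm_sq_fourierR φ).const_mul m)
        ((integrable_symbol_sq_mul hα φ T).const_mul (v - m))]
    refine integral_congr_ae (ae_of_all _ fun η => ?_)
    simp only
    ring
  simp_rw [e1]
  rw [integral_const_mul, h, e2]
  ring

theorem tendsto_symbol_div (hα : 0 < α) (η : ℝ) :
    Tendsto (fun T => symbol α (η / T)) atTop (nhds 1) := by
  have h := ((continuous_symbol hα).tendsto 0).comp
    (tendsto_id.const_div_atTop η)
  simpa [symbol, Real.zero_rpow hα.ne', Function.comp_def] using h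

/-! ### Limit of the variances when `θ` is not constant -/

theorem multiplier_bounds {m v s : ℝ} (hm : 0 ≤ m) (hv : 0 ≤ v) (h0 : 0 ≤ s) (h1 : s ≤ 1) :
    0 ≤ m + (v - m) * s ∧ m + (v - m) * s ≤ m + v := by
  constructor <;> nlinarith [mul_nonneg hm h0, mul_nonneg hv h0]

theorem tendsto_integral_multiplier (hα : 0 < α) {m v : ℝ} (hm : 0 ≤ m) (hv : 0 ≤ v)
    (φ : 𝓢(ℝ, ℝ)) :
    Tendsto (fun T => ∫ η, (m + (v - m) * symbol α (η / T) ^ 2) * ‖fourierR φ η‖ ^ 2) atTop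
      (nhds (v * ∫ x, φ x ^ 2)) := by
  rw [← integral_norm_sq_fourierR, ← integral_const_mul]
  refine tendsto_integral_filter_of_dominated_convergence
    (fun η => (m + v) * ‖fourierR φ η‖ ^ 2) (Eventually.of_forall fun T => ?_)
    (Eventually.of_forall fun T => ae_of_all _ fun η => ?_)
    ((integrable_norm_sq_fourierR φ).const_mul _) (ae_of_all _ fun η => ?_)
  · have := continuous_symbol hα
    have := (fourierR φ).continuous
    exact Continuous.aestronglyMeasurable (by fun_prop)
  · have hb := multiplier_bounds hm hv (sq_nonneg (symbol α (η / T)))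
      (pow_le_one₀ (symbol_nonneg (η / T)) (symbol_le_one (η / T)))
    rw [Real.norm_of_nonneg (mul_nonneg hb.1 (by positivity))]
    exact mul_le_mul_of_nonneg_right hb.2 (by positivity)
  · have := ((((tendsto_symbol_div hα η).pow 2).const_mul (v - m)).const_add m).mul_const
      (‖fourierR φ η‖ ^ 2)
    simpa using this

theorem integral_multiplier_le {m v : ℝ} (hm : 0 ≤ m) (hv : 0 ≤ v)
    (φ : 𝓢(ℝ, ℝ)) (T : ℝ) :
    ∫ η, (m + (v - m) * symbol α (η / T) ^ 2) * ‖fourierR φ η‖ ^ 2 ≤ (m + v) * energy φ := by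
  rw [(energy_eq φ).2, ← integral_const_mul]
  refine integral_mono_of_nonneg (ae_of_all _ fun η => ?_) ((energy_eq φ).1.const_mul _)
    (ae_of_all _ fun η => ?_)
  all_goals
    have hb := multiplier_bounds hm hv (sq_nonneg (symbol α (η / T)))
      (pow_le_one₀ (symbol_nonneg (η / T)) (symbol_le_one (η / T)))
  · exact mul_nonneg hb.1 (by positivity)
  · refine mul_le_mul hb.2 ?_ (by positivity) (by positivity)
    nlinarith [sq_nonneg (2 * Real.pi * η), sq_nonneg ‖fourierR φ η‖]

/-! ### Limit of the variances when `θ` is constant -/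

theorem abs_rpow_le_one_add_sq (hα : 0 < α) (hα2 : α ≤ 2) (x : ℝ) : |x| ^ α ≤ 1 + x ^ 2 := by
  rcases le_total |x| 1 with h | h
  · exact (Real.rpow_le_one (abs_nonneg x) h hα.le).trans (by nlinarith [sq_nonneg x])
  · refine (Real.rpow_le_rpow_of_exponent_le h hα2).trans ?_
    rw [Real.rpow_two, sq_abs]
    linarith

theorem symbol_div_sq {T : ℝ} (hT : 0 < T) (η : ℝ) :
    symbol α (η / T) ^ 2 = Real.exp (-(2 * |2 * Real.pi * η| ^ α) * (T ^ α)⁻¹) := by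
  rw [symbol, ← Real.exp_nat_mul, ← mul_div_assoc, abs_div, abs_of_pos hT,
    Real.div_rpow (abs_nonneg _) hT.le]
  congr 1
  push_cast
  ring

theorem rpow_mul_one_sub_symbol_le {T : ℝ} (hT : 0 < T) (η : ℝ) :
    T ^ α * (1 - symbol α (η / T) ^ 2) ≤ 2 * |2 * Real.pi * η| ^ α := by
  have hTα : 0 < T ^ α := Real.rpow_pos_of_pos hT α
  have h := Real.add_one_le_exp (-(2 * |2 * Real.pi * η| ^ α) * (T ^ α)⁻¹)
  rw [← symbol_div_sq hT] at h
  calc T ^ α * (1 - symbol α (η / T) ^ 2)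
      ≤ T ^ α * (2 * |2 * Real.pi * η| ^ α * (T ^ α)⁻¹) := by
        refine mul_le_mul_of_nonneg_left ?_ hTα.le
        linarith
    _ = 2 * |2 * Real.pi * η| ^ α := by field_simp

/-- The limit is the derivative at `0` of `x ↦ 1 - exp (-2 |2πη|^α x)`, along `x = T^{-α}`. -/
theorem tendsto_rpow_mul_one_sub_symbol (hα : 0 < α) (η : ℝ) :
    Tendsto (fun T => T ^ α * (1 - symbol α (η / T) ^ 2)) atTop
      (nhds (2 * |2 * Real.pi * η| ^ α)) := by
  set c := 2 * |2 * Real.pi * η| ^ α with hc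
  have hd : HasDerivAt (fun x => Real.exp (-c * x)) (-c) 0 := by
    simpa using ((hasDerivAt_id (0 : ℝ)).const_mul (-c)).exp
  have hinv : Tendsto (fun T : ℝ => (T ^ α)⁻¹) atTop (nhdsWithin 0 {0}ᶜ) :=
    (tendsto_inv_atTop_nhdsGT_zero.comp (tendsto_rpow_atTop hα)).mono_right
      (nhdsWithin_mono _ fun x hx => ne_of_gt hx)
  have h := ((hasDerivAt_iff_tendsto_slope.1 hd).comp hinv).neg
  rw [neg_neg] at h
  refine h.congr' ?_
  filter_upwards [eventually_gt_atTop 0] with T hT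
  rw [symbol_div_sq hT]
  simp [slope, hc]
  ring

theorem integrable_rpow_mul (hα : 0 < α) (hα2 : α ≤ 2) (φ : 𝓢(ℝ, ℝ)) :
    Integrable fun η => 2 * |2 * Real.pi * η| ^ α * ‖fourierR φ η‖ ^ 2 := by
  refine ((energy_eq φ).1.const_mul 2).mono' (Continuous.aestronglyMeasurable ?_)
    (ae_of_all _ fun η => ?_)
  · have : Continuous fun η : ℝ => |2 * Real.pi * η| ^ α :=
      (Real.continuous_rpow_const hα.le).comp (by fun_prop)
    have := (fourierR φ).continuous
    fun_prop
  · rw [Real.norm_of_nonneg (by positivity)]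
    nlinarith [mul_le_mul_of_nonneg_right (abs_rpow_le_one_add_sq hα hα2 (2 * Real.pi * η))
      (sq_nonneg ‖fourierR φ η‖)]

theorem tendsto_integral_one_sub_symbol (hα : 0 < α) (hα2 : α ≤ 2) (φ : 𝓢(ℝ, ℝ)) :
    Tendsto (fun T => ∫ η, T ^ α * (1 - symbol α (η / T) ^ 2) * ‖fourierR φ η‖ ^ 2) atTop
      (nhds (∫ η, 2 * |2 * Real.pi * η| ^ α * ‖fourierR φ η‖ ^ 2)) := by
  refine tendsto_integral_filter_of_dominated_convergence
    (fun η => 2 * |2 * Real.pi * η| ^ α * ‖fourierR φ η‖ ^ 2) (Eventually.of_forall fun T => ?_)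
    ?_ (integrable_rpow_mul hα hα2 φ)
    (ae_of_all _ fun η => (tendsto_rpow_mul_one_sub_symbol hα η).mul_const _)
  · have := continuous_symbol hα
    have := (fourierR φ).continuous
    exact Continuous.aestronglyMeasurable (by fun_prop)
  · filter_upwards [eventually_gt_atTop 0] with T hT
    refine ae_of_all _ fun η => ?_
    rw [Real.norm_of_nonneg]
    · exact mul_le_mul_of_nonneg_right (rpow_mul_one_sub_symbol_le hT η) (by positivity)
    · exact mul_nonneg (mul_nonneg (by positivity) (sub_nonneg.2
        (pow_le_one₀ (symbol_nonneg _) (symbol_le_one _)))) (by positivity)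

theorem integral_rpow_mul_le (hα : 0 < α) (hα2 : α ≤ 2) (φ : 𝓢(ℝ, ℝ)) :
    ∫ η, 2 * |2 * Real.pi * η| ^ α * ‖fourierR φ η‖ ^ 2 ≤ 2 * energy φ := by
  rw [(energy_eq φ).2, ← integral_const_mul]
  refine integral_mono (integrable_rpow_mul hα hα2 φ) ((energy_eq φ).1.const_mul _) fun η => ?_
  simp only
  nlinarith [mul_le_mul_of_nonneg_right (abs_rpow_le_one_add_sq hα hα2 (2 * Real.pi * η))
    (sq_nonneg ‖fourierR φ η‖)]

theorem integral_one_sub_symbol_le (hα : 0 < α) (hα2 : α ≤ 2) (φ : 𝓢(ℝ, ℝ)) {T : ℝ}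
    (hT : 0 < T) :
    ∫ η, T ^ α * (1 - symbol α (η / T) ^ 2) * ‖fourierR φ η‖ ^ 2 ≤ 2 * energy φ := by
  refine (integral_mono_of_nonneg (ae_of_all _ fun η => ?_) (integrable_rpow_mul hα hα2 φ)
    (ae_of_all _ fun η => ?_)).trans (integral_rpow_mul_le hα hα2 φ)
  · exact mul_nonneg (mul_nonneg (by positivity) (sub_nonneg.2
      (pow_le_one₀ (symbol_nonneg _) (symbol_le_one _)))) (by positivity)
  · exact mul_le_mul_of_nonneg_right (rpow_mul_one_sub_symbol_le hT η) (by positivity)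

/-! ### Existence of the limits -/

theorem integral_sq_le_energy (φ : 𝓢(ℝ, ℝ)) : ∫ x, φ x ^ 2 ≤ energy φ :=
  integral_mono (integrable_sq φ) (integrable_energy φ) fun _ =>
    le_add_of_nonneg_right (sq_nonneg _)

theorem exists_isWhiteNoise : ∃ Q : Measure SPrime, IsProbabilityMeasure Q ∧ IsWhiteNoise id Q := by
  have hJ : ∀ φ ψ : 𝓢(ℝ, ℝ), inner ℝ (SchwartzMap.toLpCLM ℝ ℝ 2 volume φ)
      (SchwartzMap.toLpCLM ℝ ℝ 2 volume ψ) = ∫ x, φ x * ψ x := fun φ ψ => by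
    rw [L2.inner_def]
    refine integral_congr_ae ?_
    filter_upwards [φ.coeFn_toLp 2 volume, ψ.coeFn_toLp 2 volume] with x h1 h2
    simp [SchwartzMap.toLpCLM_apply, h1, h2, mul_comm]
  obtain ⟨Q, hQ, hG, hc⟩ := exists_isCenteredGaussian
    (SchwartzMap.toLpCLM ℝ ℝ 2 (volume : Measure ℝ)).toLinearMap zero_le_one fun φ => by
      rw [← real_inner_self_eq_norm_sq, one_mul]
      refine (hJ φ φ).trans_le ?_
      simpa only [← sq] using integral_sq_le_energy φ
  exact ⟨Q, hQ, { hG with covariance := fun φ ψ => (hc φ ψ).trans (hJ φ ψ) }⟩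

theorem fourierR_neg (φ : 𝓢(ℝ, ℝ)) (η : ℝ) :
    fourierR φ (-η) = (starRingEnd ℂ) (fourierR φ η) := by
  simp only [fourierR_eq, Real.fourier_eq', ← integral_conj]
  refine integral_congr_ae (ae_of_all _ fun x => ?_)
  simp [← Complex.exp_conj, Complex.conj_ofNat]

theorem integrable_rpow_mul_mul (hα : 0 < α) (hα2 : α ≤ 2) (φ ψ : 𝓢(ℝ, ℝ)) :
    Integrable fun η =>
      fourierR φ η * (starRingEnd ℂ) (fourierR ψ η) * ((|2 * Real.pi * η| ^ α : ℝ) : ℂ) := by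
  refine ((integrable_rpow_mul hα hα2 φ).add (integrable_rpow_mul hα hα2 ψ)).mono'
    (Continuous.aestronglyMeasurable ?_) (ae_of_all _ fun η => ?_)
  · have : Continuous fun η : ℝ => |2 * Real.pi * η| ^ α :=
      (Real.continuous_rpow_const hα.le).comp (by fun_prop)
    have h1 := (fourierR φ).continuous
    have h2 := (fourierR ψ).continuous
    have h3 : Continuous fun η => (starRingEnd ℂ) (fourierR ψ η) := Complex.continuous_conj.comp h2
    fun_prop
  · have hp : 0 ≤ |2 * Real.pi * η| ^ α := by positivity
    rw [norm_mul, norm_mul, RCLike.norm_conj, Complex.norm_real, Real.norm_of_nonneg hp]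
    simp only [Pi.add_apply]
    nlinarith [mul_nonneg hp (sq_nonneg (‖fourierR φ η‖ - ‖fourierR ψ η‖)),
      mul_nonneg hp (sq_nonneg ‖fourierR φ η‖), mul_nonneg hp (sq_nonneg ‖fourierR ψ η‖)]

/-- The covariance of the limit, rewritten as a real integral. -/
theorem integral_fourierHat (hα : 0 < α) (hα2 : α ≤ 2) (φ ψ : 𝓢(ℝ, ℝ)) :
    ∫ x, fourierHat φ x * (starRingEnd ℂ) (fourierHat ψ x) * ((|x| ^ α : ℝ) : ℂ) =
      ((2 * Real.pi * ∫ η, |2 * Real.pi * η| ^ α * inner ℝ (fourierR φ η) (fourierR ψ η) : ℝ) :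
        ℂ) := by
  have h := integral_comp_neg_div_two_pi fun η =>
    fourierR φ η * (starRingEnd ℂ) (fourierR ψ η) * ((|2 * Real.pi * η| ^ α : ℝ) : ℂ)
  have e : ∀ x : ℝ, |2 * Real.pi * (-x / (2 * Real.pi))| = |x| := fun x => by
    rw [mul_div_cancel₀ _ (by positivity), abs_neg]
  simp only [e, ← fourierHat_eq_fourierR] at h
  rw [h, integral_eq_ofReal_of_conj (integrable_rpow_mul_mul hα hα2 φ ψ)]
  · rw [Complex.real_smul, ← Complex.ofReal_mul]
    congr 2
    refine integral_congr_ae (ae_of_all _ fun η => ?_)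
    simp only [Complex.re_mul_ofReal, Complex.inner]
    simp
    ring
  · intro η
    simp [fourierR_neg]

theorem memLp_rpow_smul (hα : 0 < α) (hα2 : α ≤ 2) {m : ℝ} (hm : 0 ≤ m) (φ : 𝓢(ℝ, ℝ)) :
    MemLp (fun η => √(2 * m * |2 * Real.pi * η| ^ α) • fourierR φ η) 2 volume := by
  have : Continuous fun η : ℝ => |2 * Real.pi * η| ^ α :=
    (Real.continuous_rpow_const hα.le).comp (by fun_prop)
  have h1 := (fourierR φ).continuous
  refine (memLp_two_iff_integrable_sq_norm (Continuous.aestronglyMeasurable (by fun_prop))).2 ?_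
  refine ((integrable_rpow_mul hα hα2 φ).const_mul m).congr (ae_of_all _ fun η => ?_)
  simp only [norm_smul, mul_pow, Real.norm_of_nonneg (Real.sqrt_nonneg _)]
  rw [Real.sq_sqrt (by positivity)]
  ring

/-- The centered Gaussian law with spectral density proportional to `|x|^α`, obtained from the map
`φ ↦ √(2m |2πη|^α) fourierR φ η` into `L²(ℝ; ℂ)`, seen as a real Hilbert space. -/
theorem exists_isCenteredGaussian_rpow (hα : 0 < α) (hα2 : α ≤ 2) {m : ℝ} (hm : 0 ≤ m) :
    ∃ Q : Measure SPrime, IsProbabilityMeasure Q ∧ IsCenteredGaussian id Q ∧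
      ∀ φ ψ : 𝓢(ℝ, ℝ), ((∫ z, z φ * z ψ ∂Q : ℝ) : ℂ) = ((m / Real.pi : ℝ) : ℂ) *
        ∫ x : ℝ, fourierHat φ x * (starRingEnd ℂ) (fourierHat ψ x) * ((|x| ^ α : ℝ) : ℂ) := by
  let J : 𝓢(ℝ, ℝ) →ₗ[ℝ] Lp ℂ 2 (volume : Measure ℝ) :=
    { toFun := fun φ => (memLp_rpow_smul hα hα2 hm φ).toLp _
      map_add' := fun φ ψ => by
        rw [← MemLp.toLp_add]
        congr 1
        ext η
        simp
      map_smul' := fun c φ => by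
        rw [RingHom.id_apply, ← MemLp.toLp_const_smul]
        congr 1
        ext η
        simp [mul_left_comm] }
  have hJ : ∀ φ ψ, inner ℝ (J φ) (J ψ) =
      2 * m * ∫ η, |2 * Real.pi * η| ^ α * inner ℝ (fourierR φ η) (fourierR ψ η) := fun φ ψ => by
    rw [L2.inner_def, ← integral_const_mul]
    refine integral_congr_ae ?_
    filter_upwards [(memLp_rpow_smul hα hα2 hm φ).coeFn_toLp,
      (memLp_rpow_smul hα hα2 hm ψ).coeFn_toLp] with η h1 h2
    change inner ℝ ((memLp_rpow_smul hα hα2 hm φ).toLp _ η)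
      ((memLp_rpow_smul hα hα2 hm ψ).toLp _ η) = _
    rw [h1, h2, real_inner_smul_left, real_inner_smul_right, ← mul_assoc,
      Real.mul_self_sqrt (by positivity), mul_assoc]
  obtain ⟨Q, hQ, hG, hc⟩ := exists_isCenteredGaussian J (K := m * 2) (by positivity) fun φ => by
    rw [← real_inner_self_eq_norm_sq, hJ, mul_assoc m]
    refine le_trans (le_of_eq ?_)
      (mul_le_mul_of_nonneg_left (integral_rpow_mul_le hα hα2 φ) hm)
    rw [← integral_const_mul, ← integral_const_mul]
    refine integral_congr_ae (ae_of_all _ fun η => ?_)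
    simp only [real_inner_self_eq_norm_sq]
    ring
  refine ⟨Q, hQ, hG, fun φ ψ => ?_⟩
  rw [hc, hJ, integral_fourierHat hα hα2, ← Complex.ofReal_mul]
  congr 1
  field_simp

/-! ### Convergence of the rescaled process -/

variable {Ω : Type*} [MeasurableSpace Ω] {P : Measure Ω}

theorem IsCenteredGaussian.const_smul {W : Ω → SPrime} (hW : IsCenteredGaussian W P) (c : ℝ) :
    IsCenteredGaussian (fun ω => c • W ω) P where
  measurable := (continuous_const_smul c).measurable.comp hW.measurable
  gaussian := hW.gaussian.smul fun _ => c
  centered φ := by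
    simp only [smul_apply, smul_eq_mul, integral_const_mul, hW.centered, mul_zero]

theorem IsDensityProcess.isCenteredGaussian_rescaled {m v : ℝ} {X : ℝ≥0 → Ω → SPrime}
    (hX : IsDensityProcess α m v X P) (F : ℝ → ℝ) (T : ℝ) :
    IsCenteredGaussian (rescaled F X T) P := by
  refine IsCenteredGaussian.const_smul (W := fun ω => (X 1 ω).comp (scale T)) ⟨?_, ?_, ?_⟩ _
  · exact (ContinuousLinearMap.precomp ℝ (scale T)).continuous.measurable.comp (hX.measurable 1)
  · exact hX.gaussian.comp_right fun φ => (1, scale T φ)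
  · exact fun φ => hX.centered 1 (scale T φ)

/-- The convergence criterion for the rescaled process. A bound for positive `T` is enough, since
`T` may be replaced by `max T 1`. -/
theorem IsDensityProcess.tendstoInDistribution_rescaled {m v : ℝ} {X : ℝ≥0 → Ω → SPrime}
    [IsProbabilityMeasure P] (hX : IsDensityProcess α m v X P) {F : ℝ → ℝ}
    {Ω' : Type*} [MeasurableSpace Ω'] {P' : Measure Ω'} [IsProbabilityMeasure P']
    {Z : Ω' → SPrime} (hZ : IsCenteredGaussian Z P') {K : ℝ} (hK : 0 ≤ K)
    (hE : ∀ T, 0 < T → ∀ φ, ∫ ω, rescaled F X T ω φ ^ 2 ∂P ≤ K * energy φ)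
    (hlim : ∀ φ, Tendsto (fun T => ∫ ω, rescaled F X T ω φ ^ 2 ∂P) atTop
      (nhds (∫ ω, Z ω φ ^ 2 ∂P'))) :
    TendstoInDistribution (fun T => rescaled F X T) atTop Z (fun _ => P) P' where
  forall_aemeasurable T := (hX.isCenteredGaussian_rescaled F T).measurable.aemeasurable
  aemeasurable_limit := hZ.measurable.aemeasurable
  tendsto := by
    have hmax : ∀ᶠ T : ℝ in atTop, max T 1 = T := by
      filter_upwards [eventually_ge_atTop 1] with T hT using max_eq_left hT
    have h := tendstoInDistribution_of_variance (l := atTop)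
      (W := fun T : ℝ => rescaled F X (max T 1))
      (fun T => hX.isCenteredGaussian_rescaled F _) hZ hK
      (fun T => hE _ (lt_max_of_lt_right one_pos))
      (fun φ => (hlim φ).congr' (by filter_upwards [hmax] with T hT; rw [hT]))
    refine h.tendsto.congr' ?_
    filter_upwards [hmax] with T hT
    simp only [hT]
    rfl

end DensityProcess

end

theorem proposition2p5
    (α : ℝ) (hα0 : 0 < α) (hα2 : α ≤ 2)
    {Ω₀ : Type*} [MeasurableSpace Ω₀] (P₀ : Measure Ω₀) [IsProbabilityMeasure P₀]
    (θ : Ω₀ → ℕ) (hθ : Measurable θ) (hθ3 : Integrable (fun ω => (θ ω : ℝ) ^ 3) P₀)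
    {Ω : Type*} [MeasurableSpace Ω] (P : Measure Ω) [IsProbabilityMeasure P]
    (X : ℝ≥0 → Ω → DensityProcess.SPrime)
    (hX : DensityProcess.IsDensityProcess α
      (∫ ω, (θ ω : ℝ) ∂P₀) (variance (fun ω => (θ ω : ℝ)) P₀) X P) :
    -- (a): the limit exists in law, and `Z̃_T` converges in law to any version of it
    (variance (fun ω => (θ ω : ℝ)) P₀ = 0 →
      (∃ (Q : Measure DensityProcess.SPrime), IsProbabilityMeasure Q ∧
        DensityProcess.IsCenteredGaussian id Q ∧
        ∀ φ ψ : 𝓢(ℝ, ℝ), ((∫ z, z φ * z ψ ∂Q : ℝ) : ℂ) =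
          (((∫ ω, (θ ω : ℝ) ∂P₀) / Real.pi : ℝ) : ℂ) *
            ∫ x : ℝ, DensityProcess.fourierHat φ x *
              (starRingEnd ℂ) (DensityProcess.fourierHat ψ x) * ((|x| ^ α : ℝ) : ℂ)) ∧
      ∀ {Ω' : Type*} [MeasurableSpace Ω'] (P' : Measure Ω') [IsProbabilityMeasure P']
        (Z : Ω' → DensityProcess.SPrime), DensityProcess.IsCenteredGaussian Z P' →
        (∀ φ ψ : 𝓢(ℝ, ℝ), ((∫ ω, Z ω φ * Z ω ψ ∂P' : ℝ) : ℂ) =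
          (((∫ ω, (θ ω : ℝ) ∂P₀) / Real.pi : ℝ) : ℂ) *
            ∫ x : ℝ, DensityProcess.fourierHat φ x *
              (starRingEnd ℂ) (DensityProcess.fourierHat ψ x) * ((|x| ^ α : ℝ) : ℂ)) →
        TendstoInDistribution
          (fun T : ℝ => DensityProcess.rescaled (fun T => Real.sqrt (T ^ (1 - α))) X T)
          atTop Z (fun _ => P) P') ∧
    -- (b): white noise exists, and `Z̃_T` converges in law to `√(Var θ)` times any version of it
    (0 < variance (fun ω => (θ ω : ℝ)) P₀ →
      (∃ (Q : Measure DensityProcess.SPrime), IsProbabilityMeasure Q ∧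
        DensityProcess.IsWhiteNoise id Q) ∧
      ∀ {Ω' : Type*} [MeasurableSpace Ω'] (P' : Measure Ω') [IsProbabilityMeasure P']
        (W : Ω' → DensityProcess.SPrime), DensityProcess.IsWhiteNoise W P' →
        TendstoInDistribution
          (fun T : ℝ => DensityProcess.rescaled (fun T => Real.sqrt T) X T)
          atTop (fun ω => Real.sqrt (variance (fun ω => (θ ω : ℝ)) P₀) • W ω)
          (fun _ => P) P') := by
  open DensityProcess in
  set m := ∫ ω, (θ ω : ℝ) ∂P₀
  set v := variance (fun ω => (θ ω : ℝ)) P₀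
  have hm : 0 ≤ m := integral_nonneg fun ω => Nat.cast_nonneg _
  refine ⟨fun hv => ⟨exists_isCenteredGaussian_rpow hα0 hα2 hm, ?_⟩,
    fun hv => ⟨exists_isWhiteNoise, ?_⟩⟩
  · intro Ω' _ P' _ Z hZ hcov
    have hvar : ∀ φ, ∫ ω, Z ω φ ^ 2 ∂P' =
        m * ∫ η, 2 * |2 * Real.pi * η| ^ α * ‖fourierR φ η‖ ^ 2 := fun φ => by
      have h := hcov φ φ
      rw [integral_fourierHat hα0 hα2, ← Complex.ofReal_mul] at h
      simp only [sq (Z _ φ)]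
      rw [Complex.ofReal_inj.1 h]
      simp only [real_inner_self_eq_norm_sq, mul_assoc]
      rw [integral_const_mul]
      field_simp
    have hT : ∀ T, 0 < T → ∀ φ,
        ∫ ω, rescaled (fun T => √(T ^ (1 - α))) X T ω φ ^ 2 ∂P =
          m * ∫ η, T ^ α * (1 - symbol α (η / T) ^ 2) * ‖fourierR φ η‖ ^ 2 := fun T hT φ => by
      rw [hX.integral_rescaled_sq hα0 _ hT, hv, Real.sq_sqrt (by positivity),
        ← Real.rpow_neg hT.le, ← integral_const_mul, ← integral_const_mul]
      refine integral_congr_ae (ae_of_all _ fun η => ?_)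
      have : T ^ (-(1 - α)) * T = T ^ α := by
        rw [← Real.rpow_add_one hT.ne']
        congr 1
        ring
      simp only [this]
      ring
    refine hX.tendstoInDistribution_rescaled hZ (K := m * 2) (by positivity)
      (fun T hT0 φ => ?_) fun φ => ?_
    · rw [hT T hT0, mul_assoc]
      exact mul_le_mul_of_nonneg_left (integral_one_sub_symbol_le hα0 hα2 φ hT0) hm
    · rw [hvar]
      refine ((tendsto_integral_one_sub_symbol hα0 hα2 φ).const_mul m).congr' ?_
      filter_upwards [eventually_gt_atTop 0] with T hT0 using (hT T hT0 φ).symm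
  · intro Ω' _ P' _ W hW
    have hvar : ∀ φ, ∫ ω, (√v • W ω) φ ^ 2 ∂P' = v * ∫ x, φ x ^ 2 := fun φ => by
      have h := hW.covariance φ φ
      simp only [← sq] at h
      simp only [smul_apply, smul_eq_mul, mul_pow]
      rw [integral_const_mul, h, Real.sq_sqrt hv.le]
    have hT : ∀ T, 0 < T → ∀ φ, ∫ ω, rescaled (fun T => √T) X T ω φ ^ 2 ∂P =
        ∫ η, (m + (v - m) * symbol α (η / T) ^ 2) * ‖fourierR φ η‖ ^ 2 := fun T hT φ => by
      rw [hX.integral_rescaled_sq hα0 _ hT, Real.sq_sqrt hT.le, inv_mul_cancel₀ hT.ne', one_mul]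
    refine hX.tendstoInDistribution_rescaled (hW.toIsCenteredGaussian.const_smul √v)
      (K := m + v) (by positivity) (fun T hT0 φ => ?_) fun φ => ?_
    · rw [hT T hT0]
      exact integral_multiplier_le hm hv.le φ T
    · rw [hvar]
      refine (tendsto_integral_multiplier hα0 hm hv.le φ).congr' ?_
      filter_upwards [eventually_gt_atTop 0] with T hT0 using (hT T hT0 φ).symm
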